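/- Let $n\ge 2$, $\sigma>0$, and let $\mu\in\mathcal K_\sigma$, that is, $\mu$ is a finite complex Borel measure on $\mathbb R^n$ with $\int d\mu=1$ whose Fourier transform $\widehat\mu(\xi)=\int e^{-i\xi\cdot x}\,d\mu(x)$ satisfies, for some constants $c,C>0$, $$c\,\min\{1,|\xi|^{2\sigma}\}\le|1-\widehat\mu(\xi)|\le C\,\min\{1,|\xi|^{2\sigma}\}\qquad(\xi\in\mathbb R^n).$$ For $t>0$ put $M_\mu^tf(x)=\int_{\mathbb R^n}f(x-ty)\,d\mu(y)$. Let $1\le p\le2$, let $p'$ be the conjugate exponent ($p'=\infty$ if $p=1$), let $f\in L^p(\mathbb R^n)$ be complex-valued, and let $\widehat f$ be its Fourier transform (given by $\int e^{-i\xi\cdot x}f(x)\,dx$ on $L^1$, by Plancherel's theorem on $L^2$, and by $L^p\subset L^1+L^2$ in general). For $\lambda>0$ put $$F(\lambda)=\max_{\omega\in S^{n-1}}|\widehat f(\lambda\omega)|\ \text{ if }p=1,\qquad F(\lambda)=\Big(\int_{S^{n-1}}|\widehat f(\lambda\omega)|^{p'}\,d\omega\Big)^{1/p'}\ \text{ if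 }1<p\le2,$$ where $d\omega$ is the surface measure on the unit sphere $S^{n-1}$. If for some $0<\alpha\le2\sigma$ $$\|M_\mu^tf-f\|_{L^p(\mathbb R^n)}=O(t^\alpha)\qquad(t\to0^+),$$ then $F\in L^\beta\big((0,\infty),\lambda^{n-1}d\lambda\big)$ for every $\beta$ (with $\beta=\infty$ allowed if $p=1$) such that $$\frac{np}{np+\alpha p-n}<\beta\le p'.$$ -/

import Mathlib

open MeasureTheory Filter Topology
open scoped ENNReal NNReal FourierTransform RealInnerProductSpace

noncomputable section

/-- The integral `∫ g dμ` of a complex-valued function `g` against a (finite) complex measure `μ`. -/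
def complexIntegral {X : Type*} [MeasurableSpace X] (μ : ComplexMeasure X) (g : X → ℂ) : ℂ :=
  VectorMeasure.integral μ g (ContinuousLinearMap.mul ℝ ℂ)

/-- The Fourier transform `μ̂(ξ) = ∫ e^{-i ξ·x} dμ(x)` of a complex Borel measure. -/
def hatMeasure {n : ℕ} (μ : ComplexMeasure (EuclideanSpace ℝ (Fin n)))
    (ξ : EuclideanSpace ℝ (Fin n)) : ℂ :=
  complexIntegral μ fun x => Complex.exp (-(Complex.I * ((⟪ξ, x⟫ : ℝ) : ℂ)))

/-- The class `K_σ`: finite complex Borel measures on `ℝⁿ` of total integral `1` with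
`|1 - μ̂(ξ)| ≍ min {1, |ξ|^{2σ}}`. -/
def KClass (n : ℕ) (σ : ℝ) : Set (ComplexMeasure (EuclideanSpace ℝ (Fin n))) :=
  {μ | μ Set.univ = 1 ∧ ∃ c C : ℝ, 0 < c ∧ 0 < C ∧ ∀ ξ : EuclideanSpace ℝ (Fin n),
    c * min 1 (‖ξ‖ ^ (2 * σ)) ≤ ‖1 - hatMeasure μ ξ‖ ∧
      ‖1 - hatMeasure μ ξ‖ ≤ C * min 1 (‖ξ‖ ^ (2 * σ))}

/-- The averaging operator `M_μ^t f (x) = ∫ f (x - t y) dμ(y)`. -/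
def averagingOp {n : ℕ} (μ : ComplexMeasure (EuclideanSpace ℝ (Fin n))) (t : ℝ)
    (f : EuclideanSpace ℝ (Fin n) → ℂ) (x : EuclideanSpace ℝ (Fin n)) : ℂ :=
  complexIntegral μ fun y => f (x - t • y)

/-- The Fourier transform `f̂(ξ) = ∫ e^{-i ξ·x} f(x) dx` of `f ∈ L¹(ℝⁿ)`, everywhere defined; it is
Mathlib's transform (with kernel `e^{-2π i ξ·x}`) evaluated at `ξ / (2π)`. -/
def hatL1 {n : ℕ} (f : EuclideanSpace ℝ (Fin n) → ℂ) (ξ : EuclideanSpace ℝ (Fin n)) : ℂ :=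
  𝓕 f ((2 * Real.pi)⁻¹ • ξ)

/-- The Fourier transform of `f ∈ L²(ℝⁿ)` in Plancherel's sense, in the same normalization
(`L²`-limit of `∫ e^{-i ξ·x} f_k(x) dx` for Schwartz `f_k → f`). -/
def hatL2 {n : ℕ} (f : EuclideanSpace ℝ (Fin n) → ℂ) (hf : MemLp f 2)
    (ξ : EuclideanSpace ℝ (Fin n)) : ℂ :=
  (𝓕 (hf.toLp f) : Lp ℂ 2 (volume : Measure (EuclideanSpace ℝ (Fin n)))) ((2 * Real.pi)⁻¹ • ξ)

/-- The part of `f` where `|f| > 1`. -/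
def largePart {n : ℕ} (f : EuclideanSpace ℝ (Fin n) → ℂ) : EuclideanSpace ℝ (Fin n) → ℂ :=
  Set.indicator {x | 1 < ‖f x‖} f

/-- The part of `f` where `|f| ≤ 1`. -/
def smallPart {n : ℕ} (f : EuclideanSpace ℝ (Fin n) → ℂ) : EuclideanSpace ℝ (Fin n) → ℂ :=
  Set.indicator {x | ‖f x‖ ≤ 1} f

theorem largePart_add_smallPart {n : ℕ} (f : EuclideanSpace ℝ (Fin n) → ℂ) :
    largePart f + smallPart f = f := by
  funext x
  by_cases h : 1 < ‖f x‖
  · simp [largePart, smallPart, h, not_le.mpr h]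
  · simp [largePart, smallPart, h, not_lt.mp h]

theorem memLp_largePart {n : ℕ} {f : EuclideanSpace ℝ (Fin n) → ℂ} {p : ℝ} (hp1 : 1 ≤ p)
    (hf : MemLp f (ENNReal.ofReal p)) : MemLp (largePart f) 1 := by
  have hp0 : 0 < p := lt_of_lt_of_le one_pos hp1
  have hint : Integrable (fun x => ‖f x‖ ^ p) := by
    have h := hf.integrable_norm_rpow (by simpa using hp0) ENNReal.ofReal_ne_top
    rwa [ENNReal.toReal_ofReal hp0.le] at h
  rw [memLp_one_iff_integrable]
  refine hint.mono' (hf.1.indicator₀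
    (nullMeasurableSet_lt aemeasurable_const hf.1.norm.aemeasurable)) (Eventually.of_forall ?_)
  intro x
  by_cases h : 1 < ‖f x‖
  · simpa [largePart, h] using Real.rpow_le_rpow_of_exponent_le h.le hp1
  · simp only [largePart, Set.indicator, Set.mem_ofPred_eq, h, if_false, norm_zero]
    positivity

theorem memLp_smallPart {n : ℕ} {f : EuclideanSpace ℝ (Fin n) → ℂ} {p : ℝ} (hp1 : 1 ≤ p)
    (hp2 : p ≤ 2) (hf : MemLp f (ENNReal.ofReal p)) : MemLp (smallPart f) 2 := by
  have hp0 : 0 < p := lt_of_lt_of_le one_pos hp1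
  have hint : Integrable (fun x => ‖f x‖ ^ p) := by
    have h := hf.integrable_norm_rpow (by simpa using hp0) ENNReal.ofReal_ne_top
    rwa [ENNReal.toReal_ofReal hp0.le] at h
  have hm : AEStronglyMeasurable (smallPart f) volume := hf.1.indicator₀
    (nullMeasurableSet_le hf.1.norm.aemeasurable aemeasurable_const)
  rw [memLp_two_iff_integrable_sq_norm hm]
  refine hint.mono' (hm.norm.pow 2) (Eventually.of_forall ?_)
  intro x
  by_cases h : ‖f x‖ ≤ 1
  · have h2 : ‖f x‖ ^ (2 : ℝ) ≤ ‖f x‖ ^ p :=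
      Real.rpow_le_rpow_of_exponent_ge_of_imp (norm_nonneg _) h hp2 (fun _ h0 => absurd h0 two_ne_zero)
    rw [Real.rpow_two] at h2
    simpa [smallPart, h] using h2
  · simp only [smallPart, Set.indicator, Set.mem_ofPred_eq, h, if_false, norm_zero]
    simp only [ne_eq, OfNat.ofNat_ne_zero, not_false_eq_true, zero_pow, norm_zero]
    positivity

/-- The Fourier transform of `f ∈ Lᵖ(ℝⁿ)`, `1 ≤ p ≤ 2`, through `Lᵖ ⊆ L¹ + L²`: the sum of the
`L¹`-transform of `f 1_{|f| > 1}` and the `L²`-transform of `f 1_{|f| ≤ 1}`. Up to null sets any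
other splitting gives the same function. -/
def hatLp {n : ℕ} (f : EuclideanSpace ℝ (Fin n) → ℂ) {p : ℝ} (hp1 : 1 ≤ p) (hp2 : p ≤ 2)
    (hf : MemLp f (ENNReal.ofReal p)) (ξ : EuclideanSpace ℝ (Fin n)) : ℂ :=
  hatL1 (largePart f) ξ + hatL2 (smallPart f) (memLp_smallPart hp1 hp2 hf) ξ

/-- The conjugate exponent `p'`, equal to `∞` for `p = 1`. -/
def conjExp (p : ℝ) : ℝ≥0∞ := if p = 1 then ∞ else ENNReal.ofReal (p / (p - 1))

/-- The spherical average `F(λ)`: the maximum of `|f̂(λω)|` over the unit sphere if `p = 1`, and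
`(∫_{S^{n-1}} |f̂(λω)|^{p'} dω)^{1/p'}` (possibly `∞`), with `dω` the surface measure, if
`1 < p ≤ 2`. -/
def sphericalAverage {n : ℕ} (f : EuclideanSpace ℝ (Fin n) → ℂ) {p : ℝ} (hp1 : 1 ≤ p)
    (hp2 : p ≤ 2) (hf : MemLp f (ENNReal.ofReal p)) (r : ℝ) : ℝ≥0∞ :=
  if p = 1 then
    ⨆ ω : Metric.sphere (0 : EuclideanSpace ℝ (Fin n)) 1,
      ‖hatL1 f (r • (ω : EuclideanSpace ℝ (Fin n)))‖ₑ
  else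
    (∫⁻ ω : Metric.sphere (0 : EuclideanSpace ℝ (Fin n)) 1,
      ‖hatLp f hp1 hp2 hf (r • (ω : EuclideanSpace ℝ (Fin n)))‖ₑ ^ (conjExp p).toReal
        ∂(volume : Measure (EuclideanSpace ℝ (Fin n))).toSphere) ^ (1 / (conjExp p).toReal)

end

/-! On the Fourier side `M_μ^t - 1` is multiplication by `μ̂(tξ) - 1`, so Hausdorff–Young turns the
hypothesis into `‖(μ̂(tξ) - 1) f̂‖_{p'} ≲ t^α`. For `t = 1/R` and `|ξ| > R` the lower bound in `K_σ`
gives `|1 - μ̂(tξ)| ≥ c`, hence `‖f̂‖_{L^{p'}(|ξ| > R)} ≲ R^{-α}` (`IsWeakFourier.exists_tail_le`).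
In polar coordinates this is a tail bound for `F` in `L^{p'}(λ^{n-1}dλ)`. On a dyadic shell at
radius `2^j`, whose measure is `≲ 2^{jn}`, Hölder bounds the `L^β` norm of `F` by a multiple of
`2^{j(n(1/β - 1/p') - α)}`. The series of `β`-th powers converges when `n(1/β - 1/p') < α`, which is
`β > np/(np + αp - n)` (`eLpNorm_lt_top_of_tail_le`).

The transform on `L^p` is handled by duality with Schwartz functions (`IsWeakFourier`): it is unique
almost everywhere, and the multiplier identity becomes Fubini plus the exchange of translation and
modulation. Hausdorff–Young, with a non-sharp constant, comes from a Marcinkiewicz-type argument: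
`f` is cut at a height depending on the level `t`, and the `L¹`–`L^∞` bound and Plancherel control
the two pieces. -/

/-! ### Complex measures: finite variation and bounded densities. -/

theorem MeasureTheory.SignedMeasure.exists_density {X : Type*} [MeasurableSpace X]
    (s : SignedMeasure X) (ν : Measure X) [IsFiniteMeasure ν] (h : s.totalVariation ≤ ν) :
    ∃ g : X → ℝ, Measurable g ∧ (∀ᵐ x ∂ν, |g x| ≤ 1) ∧
      ∀ t, MeasurableSet t → s t = ∫ x in t, g x ∂ν := by
  have hp : s.toJordanDecomposition.posPart ≤ ν :=
    (Measure.le_add_right le_rfl).trans h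
  have hn : s.toJordanDecomposition.negPart ≤ ν :=
    (Measure.le_add_left le_rfl).trans h
  have hint : ∀ m : Measure X, [IsFiniteMeasure m] →
      Integrable (fun x => (m.rnDeriv ν x).toReal) ν := fun m _ => Measure.integrable_toReal_rnDeriv
  -- Both Jordan parts are dominated by `ν`, so each derivative lies in `[0, 1]` and the difference
  -- in `[-1, 1]`.
  refine ⟨fun x => (s.toJordanDecomposition.posPart.rnDeriv ν x).toReal
    - (s.toJordanDecomposition.negPart.rnDeriv ν x).toReal, ?_, ?_, ?_⟩
  · exact (Measure.measurable_rnDeriv _ _).ennreal_toReal.sub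
      (Measure.measurable_rnDeriv _ _).ennreal_toReal
  · filter_upwards [Measure.rnDeriv_le_one_of_le hp, Measure.rnDeriv_le_one_of_le hn] with x h1 h2
    have h1' := ENNReal.toReal_mono ENNReal.one_ne_top h1
    have h2' := ENNReal.toReal_mono ENNReal.one_ne_top h2
    simp only [ENNReal.toReal_one] at h1' h2'
    rw [abs_le]
    constructor <;> linarith [ENNReal.toReal_nonneg
      (a := s.toJordanDecomposition.posPart.rnDeriv ν x), ENNReal.toReal_nonneg
      (a := s.toJordanDecomposition.negPart.rnDeriv ν x)]
  · intro t ht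
    rw [integral_sub (hint _).integrableOn (hint _).integrableOn,
      Measure.setIntegral_toReal_rnDeriv (Measure.absolutelyContinuous_of_le hp),
      Measure.setIntegral_toReal_rnDeriv (Measure.absolutelyContinuous_of_le hn)]
    conv_lhs => rw [← s.toSignedMeasure_toJordanDecomposition]
    simp [JordanDecomposition.toSignedMeasure, ht]

theorem ComplexMeasure.totalVariation_re_le {X : Type*} [MeasurableSpace X]
    (μ : ComplexMeasure X) : (ComplexMeasure.re μ).totalVariation ≤ μ.variation := by
  rw [SignedMeasure.totalVariation_eq_variation]
  refine VectorMeasure.variation_le_of_forall_enorm_le fun E _ =>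
    le_trans ?_ (μ.enorm_measure_le_variation E)
  rw [ComplexMeasure.re_apply, enorm_le_iff_norm_le]
  exact Complex.abs_re_le_norm _

theorem ComplexMeasure.totalVariation_im_le {X : Type*} [MeasurableSpace X]
    (μ : ComplexMeasure X) : (ComplexMeasure.im μ).totalVariation ≤ μ.variation := by
  rw [SignedMeasure.totalVariation_eq_variation]
  refine VectorMeasure.variation_le_of_forall_enorm_le fun E _ =>
    le_trans ?_ (μ.enorm_measure_le_variation E)
  rw [ComplexMeasure.im_apply, enorm_le_iff_norm_le]
  exact Complex.abs_im_le_norm _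

/-- The variation is the least measure dominating `|μ(E)|`, and the finite total variations of the
real and imaginary parts add up to such a measure. -/
instance ComplexMeasure.isFiniteMeasure_variation {X : Type*} [MeasurableSpace X]
    (μ : ComplexMeasure X) : IsFiniteMeasure μ.variation := by
  refine isFiniteMeasure_of_le ((ComplexMeasure.re μ).totalVariation
    + (ComplexMeasure.im μ).totalVariation) (VectorMeasure.variation_le_of_forall_enorm_le ?_)
  intro E _
  have h : μ E = ((ComplexMeasure.re μ E : ℝ) : ℂ) + (ComplexMeasure.im μ E : ℝ) * Complex.I :=
    (Complex.re_add_im _).symm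
  rw [h, Measure.add_apply]
  refine (enorm_add_le _ _).trans (add_le_add ?_ ?_)
  · simpa [enorm_eq_nnnorm] using (ComplexMeasure.re μ).enorm_le_totalVariation E
  · simpa [enorm_eq_nnnorm] using (ComplexMeasure.im μ).enorm_le_totalVariation E

/-- Integration against a complex measure is integration of the product with a bounded density
against its variation. -/
theorem exists_complexIntegral_eq_integral_mul {X : Type*} [MeasurableSpace X]
    (μ : ComplexMeasure X) : ∃ h : X → ℂ, Measurable h ∧ (∀ᵐ x ∂μ.variation, ‖h x‖ ≤ 2) ∧
      ∀ g : X → ℂ, Integrable g μ.variation →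
        complexIntegral μ g = ∫ x, g x * h x ∂μ.variation := by
  obtain ⟨a, ha, ha1, haμ⟩ := (ComplexMeasure.re μ).exists_density μ.variation
    (ComplexMeasure.totalVariation_re_le μ)
  obtain ⟨b, hb, hb1, hbμ⟩ := (ComplexMeasure.im μ).exists_density μ.variation
    (ComplexMeasure.totalVariation_im_le μ)
  have hhm : Measurable fun x => (a x : ℂ) + b x * Complex.I := by fun_prop
  have hh2 : ∀ᵐ x ∂μ.variation, ‖(a x : ℂ) + b x * Complex.I‖ ≤ 2 := by
    filter_upwards [ha1, hb1] with x h1 h2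
    refine (norm_add_le _ _).trans ?_
    simp only [norm_mul, Complex.norm_real, Complex.norm_I, mul_one, Real.norm_eq_abs]
    linarith
  have hai : Integrable (fun x => (a x : ℂ)) μ.variation :=
    (Integrable.of_bound ha.aestronglyMeasurable 1 ha1).ofReal
  have hbi : Integrable (fun x => (b x : ℂ) * Complex.I) μ.variation :=
    (Integrable.of_bound hb.aestronglyMeasurable 1 hb1).ofReal.mul_const _
  have hmul : ∀ g : X → ℂ, Integrable g μ.variation →
      Integrable (fun x => g x * ((a x : ℂ) + b x * Complex.I)) μ.variation := fun g hg =>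
    hg.mul_bdd (c := 2) hhm.aestronglyMeasurable hh2
  refine ⟨fun x => (a x : ℂ) + b x * Complex.I, hhm, hh2, fun g hg => ?_⟩
  unfold complexIntegral
  refine Integrable.induction (fun g => VectorMeasure.integral μ g (ContinuousLinearMap.mul ℝ ℂ)
    = ∫ x, g x * ((a x : ℂ) + b x * Complex.I) ∂μ.variation) ?_ ?_ ?_ ?_ hg
  · intro c s hs _
    rw [VectorMeasure.integral_indicator hs, VectorMeasure.setIntegral_const]
    have h1 : ∀ x, s.indicator (fun _ => c) x * ((a x : ℂ) + b x * Complex.I)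
        = s.indicator (fun x => c * ((a x : ℂ) + b x * Complex.I)) x := by
      intro x
      by_cases hx : x ∈ s <;> simp [hx]
    simp_rw [h1]
    rw [integral_indicator hs, integral_const_mul, integral_add hai.integrableOn hbi.integrableOn,
      integral_mul_const, integral_complex_ofReal, integral_complex_ofReal, ← haμ s hs, ← hbμ s hs]
    rw [ContinuousLinearMap.mul_apply']
    congr 1
    exact (Complex.re_add_im _).symm
  · intro f g _ hf hg ihf ihg
    rw [VectorMeasure.integral_add hf hg, ihf, ihg, ← integral_add (hmul f hf) (hmul g hg)]
    simp only [Pi.add_apply, add_mul]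
  -- Both sides are continuous in the `L¹` norm; the Lipschitz constant 2 is the bound on the
  -- density.
  · refine isClosed_eq VectorMeasure.continuous_integral (LipschitzWith.continuous (K := 2)
      (LipschitzWith.of_dist_le_mul fun f g => ?_))
    have hf := L1.integrable_coeFn f
    have hg := L1.integrable_coeFn g
    rw [dist_eq_norm, dist_eq_norm, ← integral_sub (hmul _ hf) (hmul _ hg), L1.norm_eq_integral_norm,
      ← integral_const_mul]
    refine norm_integral_le_of_norm_le ((L1.integrable_coeFn (f - g)).norm.const_mul _) ?_
    filter_upwards [hh2, Lp.coeFn_sub f g] with x hx hfg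
    rw [← sub_mul, norm_mul, hfg, Pi.sub_apply, mul_comm]
    exact mul_le_mul_of_nonneg_right hx (norm_nonneg _)
  · intro f g hfg hf ih
    rw [← VectorMeasure.integral_congr_ae hfg, ih]
    exact integral_congr_ae (by filter_upwards [hfg] with x hx; rw [hx])

/-! ### Fourier transforms defined by duality with Schwartz functions. -/

section WeakFourier

variable {E : Type*} [NormedAddCommGroup E] [InnerProductSpace ℝ E] [FiniteDimensional ℝ E]
  [MeasurableSpace E] [BorelSpace E]

/-- `g` is the Fourier transform of `f` in the sense of tempered distributions. -/
structure IsWeakFourier (f g : E → ℂ) : Prop where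
  locallyIntegrable : LocallyIntegrable g
  integrable_mul_left : ∀ φ : SchwartzMap E ℂ, Integrable fun x => φ x * f x
  integrable_mul_right : ∀ φ : SchwartzMap E ℂ, Integrable fun x => φ x * g x
  integral_eq : ∀ φ : SchwartzMap E ℂ, ∫ x, φ x * g x = ∫ x, 𝓕 φ x * f x

theorem MeasureTheory.MemLp.integrable_schwartzMap_mul {f : E → ℂ} {p : ℝ≥0∞} (hp : 1 ≤ p)
    (hf : MemLp f p) (φ : SchwartzMap E ℂ) : Integrable fun x => φ x * f x := by
  have : ENNReal.HolderConjugate (ENNReal.conjExponent p) p :=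
    (ENNReal.HolderConjugate.conjExponent hp).symm
  exact MemLp.integrable_mul (φ.memLp (ENNReal.conjExponent p)) hf

namespace IsWeakFourier

/-- Smooth compactly supported functions are Schwartz, and they separate locally integrable
functions up to null sets. -/
theorem ae_unique {f g g' : E → ℂ} (h : IsWeakFourier f g) (h' : IsWeakFourier f g') :
    g =ᵐ[volume] g' := by
  refine ae_eq_of_integral_contDiff_smul_eq h.locallyIntegrable h'.locallyIntegrable ?_
  intro φ hφ hc
  have hφ' : ContDiff ℝ (⊤ : ℕ∞) fun x => (φ x : ℂ) := Complex.ofRealCLM.contDiff.comp hφ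
  have hc' : HasCompactSupport fun x => (φ x : ℂ) := hc.comp_left (g := Complex.ofReal) rfl
  have hψ : ∀ x, hc'.toSchwartzMap hφ' x = (φ x : ℂ) := fun x => rfl
  generalize hc'.toSchwartzMap hφ' = ψ at hψ
  simp only [Complex.real_smul, ← hψ]
  rw [h.integral_eq, h'.integral_eq]

theorem add {f g f' g' : E → ℂ} (h : IsWeakFourier f g) (h' : IsWeakFourier f' g') :
    IsWeakFourier (fun x => f x + f' x) (fun x => g x + g' x) where
  locallyIntegrable := h.locallyIntegrable.add h'.locallyIntegrable
  integrable_mul_left φ := by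
    simpa only [mul_add] using! (h.integrable_mul_left φ).add (h'.integrable_mul_left φ)
  integrable_mul_right φ := by
    simpa only [mul_add] using! (h.integrable_mul_right φ).add (h'.integrable_mul_right φ)
  integral_eq φ := by
    simp only [mul_add]
    rw [integral_add (h.integrable_mul_right φ) (h'.integrable_mul_right φ),
      integral_add (h.integrable_mul_left _) (h'.integrable_mul_left _), h.integral_eq,
      h'.integral_eq]

theorem sub {f g f' g' : E → ℂ} (h : IsWeakFourier f g) (h' : IsWeakFourier f' g') :
    IsWeakFourier (fun x => f x - f' x) (fun x => g x - g' x) where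
  locallyIntegrable := h.locallyIntegrable.sub h'.locallyIntegrable
  integrable_mul_left φ := by
    simpa only [mul_sub] using! (h.integrable_mul_left φ).sub (h'.integrable_mul_left φ)
  integrable_mul_right φ := by
    simpa only [mul_sub] using! (h.integrable_mul_right φ).sub (h'.integrable_mul_right φ)
  integral_eq φ := by
    simp only [mul_sub]
    rw [integral_sub (h.integrable_mul_right φ) (h'.integrable_mul_right φ),
      integral_sub (h.integrable_mul_left _) (h'.integrable_mul_left _), h.integral_eq,
      h'.integral_eq]

theorem congr {f g f' g' : E → ℂ} (h : IsWeakFourier f g) (hf : f =ᵐ[volume] f')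
    (hg : g =ᵐ[volume] g') : IsWeakFourier f' g' where
  locallyIntegrable := h.locallyIntegrable.congr hg
  integrable_mul_left φ := (h.integrable_mul_left φ).congr
    (by filter_upwards [hf] with x hx; rw [hx])
  integrable_mul_right φ := (h.integrable_mul_right φ).congr
    (by filter_upwards [hg] with x hx; rw [hx])
  integral_eq φ := by
    have h1 : ∫ x, φ x * g' x = ∫ x, φ x * g x :=
      integral_congr_ae (by filter_upwards [hg] with x hx; rw [hx])
    have h2 : ∫ x, 𝓕 φ x * f' x = ∫ x, 𝓕 φ x * f x :=
      integral_congr_ae (by filter_upwards [hf] with x hx; rw [hx])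
    rw [h1, h2, h.integral_eq]

theorem zero : IsWeakFourier (fun _ : E => 0) (fun _ => 0) where
  locallyIntegrable := locallyIntegrable_zero
  integrable_mul_left φ := by simp
  integrable_mul_right φ := by simp
  integral_eq φ := by simp

/-- This is the multiplication formula `∫ φ f̂ = ∫ φ̂ f`. -/
theorem of_integrable {f : E → ℂ} (hf : Integrable f) : IsWeakFourier f (𝓕 f) := by
  have hcont : Continuous (𝓕 f) := VectorFourier.fourierIntegral_continuous
    Real.continuous_fourierChar (by simpa using! continuous_inner) hf
  have hbdd : ∀ x, ‖𝓕 f x‖ ≤ ∫ y, ‖f y‖ := fun x =>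
    VectorFourier.norm_fourierIntegral_le_integral_norm _ _ _ _ _
  refine ⟨hcont.locallyIntegrable, fun φ => (memLp_one_iff_integrable.2
    hf).integrable_schwartzMap_mul le_rfl φ, fun φ => ?_, fun φ => ?_⟩
  · exact φ.integrable.mul_bdd hcont.aestronglyMeasurable (Eventually.of_forall hbdd)
  · have h := VectorFourier.integral_fourierIntegral_smul_eq_flip (μ := (volume : Measure E))
      (ν := (volume : Measure E)) (L := innerₗ E) (e := Real.fourierChar) Real.continuous_fourierChar
      (by simpa using! continuous_inner) hf φ.integrable
    rw [flip_innerₗ] at h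
    simp only [smul_eq_mul, mul_comm (f _)] at h
    simp only [mul_comm (φ _)]
    exact h

theorem of_memLp_two {f : E → ℂ} (hf : MemLp f 2) :
    IsWeakFourier f (𝓕 (hf.toLp f) : Lp ℂ 2 (volume : Measure E)) := by
  have hg := Lp.memLp (𝓕 (hf.toLp f) : Lp ℂ 2 (volume : Measure E))
  refine ⟨hg.locallyIntegrable (by norm_num), hf.integrable_schwartzMap_mul (by norm_num),
    hg.integrable_schwartzMap_mul (by norm_num), fun φ => ?_⟩
  have h := congrArg (fun T => T φ) (Lp.fourier_toTemperedDistribution_eq (hf.toLp f))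
  simp only [TemperedDistribution.fourier_apply, Lp.toTemperedDistribution_apply, smul_eq_mul] at h
  rw [← h]
  exact integral_congr_ae (by filter_upwards [hf.coeFn_toLp] with x hx; rw [hx])

end IsWeakFourier

end WeakFourier

/-! ### Measurability and integrability of `f (x - t y)`. -/

section Averaging

variable {E : Type*} [NormedAddCommGroup E] [InnerProductSpace ℝ E] [FiniteDimensional ℝ E]
  [MeasurableSpace E] [BorelSpace E]

/-- The shear `(y, x) ↦ (y, x - t y)` preserves `ν × dx` by translation invariance, whatever `ν` is.
So changing `f` on a null set changes `f (x - t y)` only on a null set of the product. -/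
theorem quasiMeasurePreserving_sub_smul (ν : Measure E) [SFinite ν] (t : ℝ) :
    Measure.QuasiMeasurePreserving (fun z : E × E => z.1 - t • z.2)
      ((volume : Measure E).prod ν) volume := by
  have h1 : MeasurePreserving (fun z : E × E => (z.1, z.2 - t • z.1)) (ν.prod volume)
      (ν.prod volume) := by
    refine (MeasurePreserving.id ν).skew_product (g := fun y x => x - t • y) ?_ ?_
    · exact measurable_snd.sub (measurable_fst.const_smul t)
    · exact Eventually.of_forall fun y => (measurePreserving_sub_right volume (t • y)).map_eq
  exact Measure.quasiMeasurePreserving_snd.comp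
    (h1.comp Measure.measurePreserving_swap).quasiMeasurePreserving

theorem aestronglyMeasurable_comp_sub_smul {f : E → ℂ} (hf : AEStronglyMeasurable f)
    (ν : Measure E) [SFinite ν] (t : ℝ) :
    AEStronglyMeasurable (fun z : E × E => f (z.1 - t • z.2)) (volume.prod ν) :=
  hf.comp_quasiMeasurePreserving (quasiMeasurePreserving_sub_smul ν t)

/-- Hölder in `x` for fixed `y` gives a bound independent of `y`, which the finite measure `ν`
integrates. This licenses Fubini on the space side. -/
theorem integrable_mul_comp_sub_smul {f w : E → ℂ} {p q : ℝ≥0∞} [hpq : q.HolderConjugate p]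
    (hf : MemLp f p) (hw : MemLp w q) (ν : Measure E) [IsFiniteMeasure ν] (t : ℝ) :
    Integrable (fun z : E × E => w z.1 * f (z.1 - t • z.2)) (volume.prod ν) := by
  have hm : AEStronglyMeasurable (fun z : E × E => w z.1 * f (z.1 - t • z.2)) (volume.prod ν) :=
    hw.1.comp_fst.mul (aestronglyMeasurable_comp_sub_smul hf.1 ν t)
  refine ⟨hm, ?_⟩
  rw [hasFiniteIntegral_iff_enorm, lintegral_prod_symm _ hm.enorm]
  have hb : ∀ y : E, ∫⁻ x, ‖w x * f (x - t • y)‖ₑ ≤ eLpNorm w q volume * eLpNorm f p volume := by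
    intro y
    have hmp := measurePreserving_sub_right (volume : Measure E) (t • y)
    have h := eLpNorm_smul_le_mul_eLpNorm (p := q) (q := p) (r := 1)
      (hf.1.comp_measurePreserving hmp) hw.1
    rw [eLpNorm_comp_measurePreserving hf.1 hmp, eLpNorm_one_eq_lintegral_enorm] at h
    exact h
  calc ∫⁻ y, ∫⁻ x, ‖w x * f (x - t • y)‖ₑ ∂volume ∂ν
      ≤ ∫⁻ _, eLpNorm w q volume * eLpNorm f p volume ∂ν := lintegral_mono hb
    _ = eLpNorm w q volume * eLpNorm f p volume * ν Set.univ := lintegral_const _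
    _ < ∞ := ENNReal.mul_lt_top (ENNReal.mul_lt_top hw.2 hf.2) (measure_lt_top _ _)

theorem ae_integrable_comp_sub_smul {f : E → ℂ} {p : ℝ≥0∞} (hp : 1 ≤ p) (hf : MemLp f p)
    (ν : Measure E) [IsFiniteMeasure ν] (t : ℝ) :
    ∀ᵐ x, Integrable (fun y => f (x - t • y)) ν := by
  have : ENNReal.HolderConjugate (ENNReal.conjExponent p) p :=
    (ENNReal.HolderConjugate.conjExponent hp).symm
  -- Indicators of balls serve as weights `w`; countably many balls exhaust the space.
  have hk : ∀ k : ℕ, ∀ᵐ x, x ∈ Metric.ball (0 : E) k →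
      Integrable (fun y => f (x - t • y)) ν := by
    intro k
    have hw : MemLp ((Metric.ball (0 : E) k).indicator fun _ => (1 : ℂ)) (ENNReal.conjExponent p) :=
      memLp_indicator_const _ measurableSet_ball _ (Or.inr measure_ball_lt_top.ne)
    filter_upwards [(integrable_mul_comp_sub_smul hf hw ν t).prod_right_ae] with x hx hxk
    simpa [hxk] using hx
  filter_upwards [ae_all_iff.2 hk] with x hx
  obtain ⟨k, hk⟩ := exists_nat_gt ‖x‖
  exact hx k (by simpa using hk)

/-- A translate of the Fourier transform of a Schwartz function is the Fourier transform of a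
modulated Schwartz function. -/
theorem SchwartzMap.exists_fourier_eq_comp_add (φ : SchwartzMap E ℂ) (a : E) :
    ∃ ψ : SchwartzMap E ℂ, (∀ ξ, ψ ξ = Real.fourierChar (-⟪a, ξ⟫) * φ ξ) ∧
      ∀ x, 𝓕 ψ x = 𝓕 φ (x + a) := by
  refine ⟨𝓕⁻ ((𝓕 φ).compSubConstCLM ℂ (-a)), fun ξ => ?_, fun x => ?_⟩
  · have h1 : φ ξ = (𝓕⁻ (𝓕 φ)) ξ := by rw [FourierTransform.fourierInv_fourier_eq]
    rw [h1, SchwartzMap.fourierInv_coe, SchwartzMap.fourierInv_coe, Real.fourierInv_eq,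
      Real.fourierInv_eq, ← integral_const_mul,
      ← integral_sub_right_eq_self (μ := (volume : Measure E)) _ a]
    refine integral_congr_ae (Eventually.of_forall fun v => ?_)
    simp only [SchwartzMap.compSubConstCLM_apply, Circle.smul_def, smul_eq_mul, sub_neg_eq_add,
      sub_add_cancel, inner_sub_left]
    rw [sub_eq_neg_add, AddChar.map_add_eq_mul, Circle.coe_mul]
    ring
  · rw [FourierTransform.fourier_fourierInv_eq]
    simp

end Averaging

/-! ### The averaging operator as a Fourier multiplier. -/

section Multiplier

variable {n : ℕ}

theorem continuous_hatMeasure (μ : ComplexMeasure (EuclideanSpace ℝ (Fin n))) :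
    Continuous (hatMeasure μ) := by
  refine VectorMeasure.continuous_of_dominated (bound := fun _ => 1) (fun ξ => ?_) (fun ξ => ?_)
    (integrable_const _) (Eventually.of_forall fun x => ?_)
  · exact (by fun_prop : Continuous fun x : EuclideanSpace ℝ (Fin n) =>
      Complex.exp (-(Complex.I * ((⟪ξ, x⟫ : ℝ) : ℂ)))).aestronglyMeasurable
  · refine Eventually.of_forall fun x => ?_
    rw [← mul_neg, mul_comm, ← Complex.ofReal_neg, Complex.norm_exp_ofReal_mul_I]
  · fun_prop

theorem fourierChar_neg_inner_smul (t : ℝ) (y ξ : EuclideanSpace ℝ (Fin n)) :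
    (Real.fourierChar (-⟪t • y, ξ⟫) : ℂ)
      = Complex.exp (-(Complex.I * ((⟪(2 * Real.pi * t) • ξ, y⟫ : ℝ) : ℂ))) := by
  rw [Real.fourierChar_apply]
  congr 1
  rw [inner_smul_left, inner_smul_left, real_inner_comm]
  push_cast
  simp
  ring

theorem averagingOp_ae_eq {μ : ComplexMeasure (EuclideanSpace ℝ (Fin n))}
    {h : EuclideanSpace ℝ (Fin n) → ℂ} (hμ : ∀ g, Integrable g μ.variation →
      complexIntegral μ g = ∫ x, g x * h x ∂μ.variation) {p : ℝ≥0∞} (hp : 1 ≤ p)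
    {f : EuclideanSpace ℝ (Fin n) → ℂ} (hf : MemLp f p) (t : ℝ) :
    averagingOp μ t f =ᵐ[volume] fun x => ∫ y, f (x - t • y) * h y ∂μ.variation := by
  filter_upwards [ae_integrable_comp_sub_smul hp hf μ.variation t] with x hx
  exact hμ _ hx

theorem aestronglyMeasurable_averagingOp (μ : ComplexMeasure (EuclideanSpace ℝ (Fin n)))
    {p : ℝ≥0∞} (hp : 1 ≤ p) {f : EuclideanSpace ℝ (Fin n) → ℂ} (hf : MemLp f p) (t : ℝ) :
    AEStronglyMeasurable (averagingOp μ t f) := by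
  obtain ⟨h, hm, -, hμ⟩ := exists_complexIntegral_eq_integral_mul μ
  refine AEStronglyMeasurable.congr ?_ (averagingOp_ae_eq hμ hp hf t).symm
  exact AEStronglyMeasurable.integral_prod_right'
    ((aestronglyMeasurable_comp_sub_smul hf.1 μ.variation t).mul
      hm.aestronglyMeasurable.comp_snd)

/-- The averaging operator acts on the Fourier side by multiplication with `μ̂(t ξ)`. -/
theorem IsWeakFourier.averagingOp (μ : ComplexMeasure (EuclideanSpace ℝ (Fin n)))
    {p : ℝ≥0∞} (hp : 1 ≤ p) {f g : EuclideanSpace ℝ (Fin n) → ℂ} (hf : MemLp f p)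
    (hfg : IsWeakFourier f g) (t : ℝ) :
    IsWeakFourier (averagingOp μ t f)
      (fun ξ => hatMeasure μ ((2 * Real.pi * t) • ξ) * g ξ) := by
  obtain ⟨h, hm, h2, hμ⟩ := exists_complexIntegral_eq_integral_mul μ
  have hconj : ENNReal.HolderConjugate (ENNReal.conjExponent p) p :=
    (ENNReal.HolderConjugate.conjExponent hp).symm
  have hae := averagingOp_ae_eq hμ hp hf t
  have h2' : ∀ᵐ z ∂((volume : Measure (EuclideanSpace ℝ (Fin n))).prod μ.variation),
      ‖h z.2‖ ≤ 2 := Measure.quasiMeasurePreserving_snd.ae h2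
  have hm' := (hm.aestronglyMeasurable (μ := μ.variation)).comp_snd
    (μ := (volume : Measure (EuclideanSpace ℝ (Fin n))))
  have hprod : ∀ φ : SchwartzMap (EuclideanSpace ℝ (Fin n)) ℂ,
      Integrable (fun z : EuclideanSpace ℝ (Fin n) × EuclideanSpace ℝ (Fin n) =>
        φ z.1 * f (z.1 - t • z.2) * h z.2) (volume.prod μ.variation) := fun φ =>
    (integrable_mul_comp_sub_smul hf (φ.memLp (ENNReal.conjExponent p)) μ.variation t).mul_bdd
      (c := 2) hm' h2'
  have hexp : ∀ ξ y : EuclideanSpace ℝ (Fin n), ‖(Real.fourierChar (-⟪t • y, ξ⟫) : ℂ)‖ = 1 :=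
    fun ξ y => Circle.norm_coe _
  have hhat : ∀ ξ, hatMeasure μ ((2 * Real.pi * t) • ξ)
      = ∫ y, (Real.fourierChar (-⟪t • y, ξ⟫) : ℂ) * h y ∂μ.variation := by
    intro ξ
    simp only [fourierChar_neg_inner_smul]
    refine hμ _ (Integrable.of_bound (Continuous.aestronglyMeasurable (by fun_prop)) 1
      (Eventually.of_forall fun y => ?_))
    rw [← fourierChar_neg_inner_smul, hexp]
  have hhatc : Continuous fun ξ => hatMeasure μ ((2 * Real.pi * t) • ξ) :=
    (continuous_hatMeasure μ).comp (continuous_const_smul _)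
  have hprod' : ∀ φ : SchwartzMap (EuclideanSpace ℝ (Fin n)) ℂ,
      Integrable (fun z : EuclideanSpace ℝ (Fin n) × EuclideanSpace ℝ (Fin n) =>
        φ z.1 * g z.1 * ((Real.fourierChar (-⟪t • z.2, z.1⟫) : ℂ) * h z.2))
        (volume.prod μ.variation) := fun φ =>
    ((hfg.integrable_mul_right φ).comp_fst μ.variation).mul_bdd (c := 2)
      (AEStronglyMeasurable.mul (Continuous.aestronglyMeasurable (by fun_prop)) hm')
      (by filter_upwards [h2'] with z hz; rw [norm_mul, hexp, one_mul]; exact hz)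
  have hright : ∀ (φ : SchwartzMap (EuclideanSpace ℝ (Fin n)) ℂ) ξ,
      φ ξ * (hatMeasure μ ((2 * Real.pi * t) • ξ) * g ξ)
        = ∫ y, φ ξ * g ξ * ((Real.fourierChar (-⟪t • y, ξ⟫) : ℂ) * h y) ∂μ.variation := by
    intro φ ξ
    rw [integral_const_mul, hhat]
    ring
  refine ⟨?_, fun φ => ?_, fun φ => ?_, fun φ => ?_⟩
  · simpa only [mul_comm] using hfg.locallyIntegrable.mul_continuous hhatc
  · refine (hprod φ).integral_prod_left.congr ?_
    filter_upwards [hae] with x hx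
    rw [hx, ← integral_const_mul]
    simp only [mul_assoc]
  · simp only [hright]
    exact (hprod' φ).integral_prod_left
  · have hL : ∫ x, 𝓕 φ x * _root_.averagingOp μ t f x
        = ∫ x, ∫ y, 𝓕 φ x * f (x - t • y) * h y ∂μ.variation := by
      refine integral_congr_ae ?_
      filter_upwards [hae] with x hx
      rw [hx, ← integral_const_mul]
      simp only [mul_assoc]
    simp only [hright]
    rw [hL]
    -- After Fubini on both sides the identity is checked for each fixed `y`, where it says that
    -- translating `f` by `t y` modulates its transform.
    refine (integral_integral_swap (hprod' φ)).trans
      (Eq.trans ?_ (integral_integral_swap (hprod (𝓕 φ))).symm)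
    refine integral_congr_ae (Eventually.of_forall fun y => ?_)
    -- Moving the modulation onto the test function reduces the claim to the weak identity for `f`
    -- tested on `ψ`.
    obtain ⟨ψ, hψ, hψ'⟩ := φ.exists_fourier_eq_comp_add (t • y)
    have h1 := hfg.integral_eq ψ
    simp only [hψ, hψ'] at h1
    have h2 : ∫ x, 𝓕 φ x * f (x - t • y) = ∫ x, 𝓕 φ (x + t • y) * f x := by
      rw [← integral_add_right_eq_self (μ := (volume : Measure (EuclideanSpace ℝ (Fin n)))) _ (t • y)]
      simp
    simp only
    rw [integral_mul_const, h2, ← h1, ← integral_mul_const]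
    refine integral_congr_ae (Eventually.of_forall fun ξ => ?_)
    simp only
    ring

end Multiplier

/-! ### The Hausdorff–Young inequality. -/

section HausdorffYoung

theorem setLIntegral_Ioc_ofReal_rpow {a T : ℝ} (ha : -1 < a) (hT : 0 ≤ T) :
    ∫⁻ t in Set.Ioc 0 T, ENNReal.ofReal (t ^ a) = ENNReal.ofReal (T ^ (a + 1) / (a + 1)) := by
  have hi : IntegrableOn (fun t : ℝ => t ^ a) (Set.Ioc 0 T) :=
    (intervalIntegrable_iff_integrableOn_Ioc_of_le hT).1
      (intervalIntegral.intervalIntegrable_rpow' ha)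
  rw [← ofReal_integral_eq_lintegral_ofReal hi, ← intervalIntegral.integral_of_le hT,
    integral_rpow (Or.inl ha), Real.zero_rpow (by linarith), sub_zero]
  filter_upwards [ae_restrict_mem measurableSet_Ioc] with t ht
  exact Real.rpow_nonneg ht.1.le _

variable {E : Type*} [NormedAddCommGroup E] [InnerProductSpace ℝ E] [FiniteDimensional ℝ E]
  [MeasurableSpace E] [BorelSpace E]

theorem IsWeakFourier.aestronglyMeasurable {f g : E → ℂ} (h : IsWeakFourier f g) :
    AEStronglyMeasurable g := h.locallyIntegrable.aestronglyMeasurable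

/-- Plancherel's theorem. -/
theorem IsWeakFourier.eLpNorm_two {f g : E → ℂ} (hf : MemLp f 2) (h : IsWeakFourier f g) :
    eLpNorm g 2 volume = eLpNorm f 2 volume := by
  rw [eLpNorm_congr_ae (h.ae_unique (IsWeakFourier.of_memLp_two hf)), ← Lp.enorm_def,
    ← Lp.enorm_toLp (hf := hf), enorm_eq_iff_norm_eq]
  exact Lp.norm_fourier_eq _

/-- The distributional inequality behind the Hausdorff–Young inequality. -/
theorem IsWeakFourier.measure_lt_norm_le {f g : E → ℂ} {p : ℝ} (hp1 : 1 < p) (hp2 : p < 2)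
    (hfm : Measurable f) (hf : Integrable fun x => ‖f x‖ ^ p) (h : IsWeakFourier f g)
    (hN : 0 < ∫ x, ‖f x‖ ^ p) {t : ℝ} (ht : 0 < t) :
    volume {x | t < ‖g x‖} ≤ ENNReal.ofReal (4 / t ^ 2) *
      ∫⁻ x in {x | t * ‖f x‖ ^ (p - 1) ≤ 2 * ∫ x, ‖f x‖ ^ p}, ENNReal.ofReal (‖f x‖ ^ (2 : ℝ)) := by
  set N := ∫ x, ‖f x‖ ^ p with hNdef
  have hp0 : 0 < p := by linarith
  -- The cut is chosen so that off `S` one has `|f| ≤ (t / 2N) |f|^p`. That part then has `L¹` norm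
  -- at most `t/2`, so `|g| > t` forces the transform of the `L²` part above `t/2`.
  set S : Set E := {x | t * ‖f x‖ ^ (p - 1) ≤ 2 * N} with hS
  have hSm : MeasurableSet S :=
    measurableSet_le ((hfm.norm.pow_const _).const_mul _) measurable_const
  have hsplit : ∀ r : ℝ, 0 ≤ r → r ^ (p - 1) * r = r ^ p := by
    intro r hr
    rw [← Real.rpow_add_one' hr (by linarith), sub_add_cancel]
  have hlb : ∀ x, ‖Sᶜ.indicator f x‖ ≤ t / (2 * N) * ‖f x‖ ^ p := by
    intro x
    by_cases hx : x ∈ S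
    · rw [Set.indicator_of_notMem (by simpa using hx), norm_zero]
      positivity
    · rw [Set.indicator_of_mem hx]
      have hx' : 2 * N < t * ‖f x‖ ^ (p - 1) := not_le.1 hx
      rw [div_mul_eq_mul_div, le_div_iff₀ (by positivity), ← hsplit _ (norm_nonneg (f x))]
      nlinarith [norm_nonneg (f x)]
  have hli : Integrable (Sᶜ.indicator f) :=
    (hf.const_mul (t / (2 * N))).mono' (hfm.indicator hSm.compl).aestronglyMeasurable
      (Eventually.of_forall hlb)
  have hl1 : ∫ x, ‖Sᶜ.indicator f x‖ ≤ t / 2 := by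
    refine (integral_mono hli.norm (hf.const_mul _) hlb).trans_eq ?_
    rw [integral_const_mul, ← hNdef]
    field_simp
  have hs2 : MemLp (S.indicator f) 2 := by
    have hm := (hfm.indicator hSm).aestronglyMeasurable (μ := (volume : Measure E))
    rw [memLp_two_iff_integrable_sq_norm hm]
    refine (hf.const_mul (((2 * N / t) ^ (p - 1)⁻¹) ^ (2 - p))).mono' (hm.norm.pow 2)
      (Eventually.of_forall fun x => ?_)
    by_cases hx : x ∈ S
    · rw [Set.indicator_of_mem hx, Real.norm_of_nonneg (by positivity)]
      have hx' : t * ‖f x‖ ^ (p - 1) ≤ 2 * N := hx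
      have h1 : ‖f x‖ ≤ (2 * N / t) ^ (p - 1)⁻¹ := by
        rw [Real.le_rpow_inv_iff_of_pos (norm_nonneg _) (by positivity) (by linarith),
          le_div_iff₀ ht]
        linarith
      have h2 : ‖f x‖ ^ 2 = ‖f x‖ ^ (2 - p) * ‖f x‖ ^ p := by
        rw [← Real.rpow_add' (norm_nonneg _) (by norm_num)]
        norm_num
      rw [h2]
      exact mul_le_mul_of_nonneg_right (Real.rpow_le_rpow (norm_nonneg _) h1 (by linarith))
        (by positivity)
    · rw [Set.indicator_of_notMem hx]
      simp only [norm_zero, ne_eq, OfNat.ofNat_ne_zero, not_false_eq_true, zero_pow]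
      positivity
  have hw2 := IsWeakFourier.of_memLp_two hs2
  set G : E → ℂ := ⇑(𝓕 (hs2.toLp (S.indicator f)) : Lp ℂ 2 (volume : Measure E)) with hG
  have hsum := (IsWeakFourier.of_integrable hli).add hw2
  have hgae : g =ᵐ[volume] fun x => 𝓕 (Sᶜ.indicator f) x + G x := by
    refine h.ae_unique (hsum.congr (Eventually.of_forall fun x => ?_) (ae_eq_refl _))
    by_cases hx : x ∈ S <;> simp [hx]
  have hsub : volume {x | t < ‖g x‖} ≤ volume {x | ENNReal.ofReal (t / 2) ≤ ‖G x‖ₑ} := by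
    refine measure_mono_ae ?_
    filter_upwards [hgae] with x hx hx'
    have hx'' : t < ‖g x‖ := hx'
    have h1 : ‖𝓕 (Sᶜ.indicator f) x‖ ≤ t / 2 :=
      (VectorFourier.norm_fourierIntegral_le_integral_norm _ _ _ _ _).trans hl1
    rw [hx] at hx''
    have h2 := norm_add_le (𝓕 (Sᶜ.indicator f) x) (G x)
    change ENNReal.ofReal (t / 2) ≤ ‖G x‖ₑ
    rw [← ofReal_norm]
    exact ENNReal.ofReal_le_ofReal (by linarith)
  have hcheb := meas_ge_le_mul_pow_eLpNorm_enorm (volume : Measure E) (p := 2) (by norm_num)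
    (by norm_num) (f := G) hw2.aestronglyMeasurable
    (ε := ENNReal.ofReal (t / 2)) (by simpa using ht) (by simp)
  refine hsub.trans (hcheb.trans_eq ?_)
  rw [hw2.eLpNorm_two hs2]
  congr 1
  · rw [← ENNReal.ofReal_inv_of_pos (by positivity), ENNReal.toReal_ofNat, ENNReal.rpow_ofNat,
      ← ENNReal.ofReal_pow (by positivity)]
    congr 1
    field_simp
    norm_num
  · rw [ENNReal.toReal_ofNat, eLpNorm_eq_lintegral_rpow_enorm_toReal (by norm_num) (by norm_num),
      ENNReal.toReal_ofNat, ← ENNReal.rpow_mul]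
    norm_num
    rw [← lintegral_indicator hSm]
    refine lintegral_congr fun x => ?_
    by_cases hx : x ∈ S
    · simp [hx]
    · simp [hx]

theorem IsWeakFourier.lintegral_rpow_le {f g : E → ℂ} {p q : ℝ} (hp1 : 1 < p) (hp2 : p < 2)
    (hq : q = p / (p - 1))
    (hfm : Measurable f) (hf : Integrable fun x => ‖f x‖ ^ p) (h : IsWeakFourier f g)
    (hN : 0 < ∫ x, ‖f x‖ ^ p) :
    ∫⁻ x, ENNReal.ofReal (‖g x‖ ^ q) ≤
      ENNReal.ofReal (q * (4 / (q - 2) * 2 ^ (q - 2)) * (∫ x, ‖f x‖ ^ p) ^ (q - 1)) := by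
  set N := ∫ x, ‖f x‖ ^ p with hNdef
  have hp0 : 0 < p := by linarith
  have hp10 : 0 < p - 1 := by linarith
  have hq2 : 2 < q := by
    rw [hq, lt_div_iff₀ hp10]; linarith
  -- This identity makes `|f|² T^(q-2)`, with `T = 2N |f|^(1-p)`, a multiple of `|f|^p`.
  have hpq : (1 - p) * (q - 2) = p - 2 := by
    rw [hq]; field_simp; ring
  rw [lintegral_rpow_eq_lintegral_meas_lt_mul volume
    (Eventually.of_forall fun x => norm_nonneg (g x)) h.aestronglyMeasurable.norm.aemeasurable
    (by linarith)]
  -- Integrand of the layer-cake formula after inserting the distributional bound. Integrating first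
  -- in `t`, over `0 < t ≤ T`, converges at 0 because `q > 2`.
  let K : ℝ → E → ℝ≥0∞ := fun t x =>
    {z : ℝ × E | z.1 * ‖f z.2‖ ^ (p - 1) ≤ 2 * N}.indicator
      (fun z => ENNReal.ofReal (4 * z.1 ^ (q - 3)) * ENNReal.ofReal (‖f z.2‖ ^ (2 : ℝ))) (t, x)
  have hKset : MeasurableSet {z : ℝ × E | z.1 * ‖f z.2‖ ^ (p - 1) ≤ 2 * N} :=
    measurableSet_le (measurable_fst.mul ((hfm.comp measurable_snd).norm.pow_const _))
      measurable_const
  have hKm : Measurable (Function.uncurry K) := by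
    refine Measurable.indicator ?_ hKset
    exact ((measurable_fst.pow_const _).const_mul _).ennreal_ofReal.mul
      (((hfm.comp measurable_snd).norm.pow_const _).ennreal_ofReal)
  have h1 : ∫⁻ t in Set.Ioi (0 : ℝ), volume {x | t < ‖g x‖} * ENNReal.ofReal (t ^ (q - 1))
      ≤ ∫⁻ t in Set.Ioi (0 : ℝ), ∫⁻ x, K t x := by
    refine setLIntegral_mono' measurableSet_Ioi fun t ht => ?_
    have ht' : 0 < t := ht
    grw [h.measure_lt_norm_le hp1 hp2 hfm hf hN ht']
    have hSm : MeasurableSet {x | t * ‖f x‖ ^ (p - 1) ≤ 2 * N} :=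
      measurableSet_le ((hfm.norm.pow_const _).const_mul _) measurable_const
    rw [mul_right_comm, ← ENNReal.ofReal_mul (by positivity), ← lintegral_indicator hSm,
      ← lintegral_const_mul _ ((hfm.norm.pow_const _).ennreal_ofReal.indicator hSm)]
    refine (lintegral_congr fun x => ?_).le
    have h4 : 4 / t ^ 2 * t ^ (q - 1) = 4 * t ^ (q - 3) := by
      have : t ^ (q - 1) = t ^ (q - 3) * t ^ 2 := by
        rw [← Real.rpow_natCast t 2, ← Real.rpow_add ht']
        norm_num
        congr 1
        ring
      rw [this]
      field_simp
    rw [h4]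
    by_cases hx : t * ‖f x‖ ^ (p - 1) ≤ 2 * N
    · simp only [K, Set.indicator, Set.mem_ofPred_eq, hx, if_true]
    · simp only [K, Set.indicator, Set.mem_ofPred_eq, hx, if_false, mul_zero]
  have h2 : ∀ x, ∫⁻ t in Set.Ioi (0 : ℝ), K t x
      ≤ ENNReal.ofReal (4 / (q - 2) * 2 ^ (q - 2) * N ^ (q - 2) * ‖f x‖ ^ p) := by
    intro x
    rcases (norm_nonneg (f x)).eq_or_lt with h0 | h0
    · have : ∀ t, K t x = 0 := by
        intro t
        simp only [K]
        refine Set.indicator_apply_eq_zero.2 fun _ => ?_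
        simp [← h0]
      simp [this]
    · set T := 2 * N * ‖f x‖ ^ (1 - p) with hT
      have hT0 : 0 ≤ T := by positivity
      have h3 : ∀ t ∈ Set.Ioi (0 : ℝ), K t x ≤ (Set.Ioc 0 T).indicator
          (fun t => ENNReal.ofReal (4 * ‖f x‖ ^ (2 : ℝ)) * ENNReal.ofReal (t ^ (q - 3))) t := by
        intro t ht
        have ht' : 0 < t := ht
        by_cases hx : t * ‖f x‖ ^ (p - 1) ≤ 2 * N
        · have htT : t ∈ Set.Ioc 0 T := by
            refine ⟨ht', ?_⟩
            have : ‖f x‖ ^ (1 - p) = (‖f x‖ ^ (p - 1))⁻¹ := by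
              rw [← Real.rpow_neg h0.le, neg_sub]
            rw [hT, this, ← div_eq_mul_inv, le_div_iff₀ (by positivity)]
            exact hx
          rw [Set.indicator_of_mem htT]
          simp only [K, Set.indicator, Set.mem_ofPred_eq, hx, if_true]
          rw [← ENNReal.ofReal_mul (by positivity), ← ENNReal.ofReal_mul (by positivity)]
          exact ENNReal.ofReal_le_ofReal (by linarith)
        · simp only [K, Set.indicator, Set.mem_ofPred_eq, hx, if_false, zero_le]
      calc ∫⁻ t in Set.Ioi (0 : ℝ), K t x
          ≤ ∫⁻ t, (Set.Ioc 0 T).indicator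
              (fun t => ENNReal.ofReal (4 * ‖f x‖ ^ (2 : ℝ)) * ENNReal.ofReal (t ^ (q - 3))) t :=
            (setLIntegral_mono' measurableSet_Ioi h3).trans (setLIntegral_le_lintegral _ _)
        _ = ENNReal.ofReal (4 * ‖f x‖ ^ (2 : ℝ)) * ENNReal.ofReal (T ^ (q - 2) / (q - 2)) := by
            rw [lintegral_indicator measurableSet_Ioc, lintegral_const_mul _ (by fun_prop),
              setLIntegral_Ioc_ofReal_rpow (by linarith) hT0]
            ring_nf
        _ ≤ _ := by
            rw [← ENNReal.ofReal_mul (by positivity)]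
            refine ENNReal.ofReal_le_ofReal (le_of_eq ?_)
            rw [hT, Real.mul_rpow (by positivity) (by positivity),
              Real.mul_rpow (by positivity) (by positivity), ← Real.rpow_mul h0.le, hpq]
            have : ‖f x‖ ^ p = ‖f x‖ ^ (2 : ℝ) * ‖f x‖ ^ (p - 2) := by
              rw [← Real.rpow_add h0]; congr 1; ring
            rw [this]
            ring
  calc _ ≤ ENNReal.ofReal q * ∫⁻ t in Set.Ioi (0 : ℝ), ∫⁻ x, K t x := by gcongr
    _ = ENNReal.ofReal q * ∫⁻ x, ∫⁻ t in Set.Ioi (0 : ℝ), K t x := by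
        rw [lintegral_lintegral_swap hKm.aemeasurable]
    _ ≤ ENNReal.ofReal q *
        ∫⁻ x, ENNReal.ofReal (4 / (q - 2) * 2 ^ (q - 2) * N ^ (q - 2) * ‖f x‖ ^ p) := by
        gcongr with x
        exact h2 x
    _ = _ := by
        have hq20 : 0 < q - 2 := by linarith
        rw [← ofReal_integral_eq_lintegral_ofReal (hf.const_mul _)
          (Eventually.of_forall fun x => by positivity), integral_const_mul, ← hNdef,
          ← ENNReal.ofReal_mul (by linarith)]
        congr 1
        have : N ^ (q - 1) = N ^ (q - 2) * N := by
          rw [← Real.rpow_add_one hN.ne']; congr 1; ring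
        rw [this]
        ring

/-- The **Hausdorff–Young inequality**, with an unspecified constant. -/
theorem IsWeakFourier.exists_eLpNorm_le {p : ℝ} (hp1 : 1 < p) (hp2 : p ≤ 2) :
    ∃ C : ℝ≥0, ∀ f g : E → ℂ, MemLp f (ENNReal.ofReal p) → IsWeakFourier f g →
      eLpNorm g (ENNReal.ofReal (p / (p - 1))) volume
        ≤ C * eLpNorm f (ENNReal.ofReal p) volume := by
  rcases hp2.eq_or_lt with rfl | hp2
  · refine ⟨1, fun f g hf h => ?_⟩
    norm_num at hf ⊢
    exact (h.eLpNorm_two hf).le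
  have hp0 : 0 < p := by linarith
  have hp10 : 0 < p - 1 := by linarith
  set q := p / (p - 1) with hq
  have hq0 : 0 < q := by positivity
  have hq2 : 0 < q - 2 := by
    rw [sub_pos, hq, lt_div_iff₀ hp10]; linarith
  set K := q * (4 / (q - 2) * 2 ^ (q - 2)) with hK
  have hK0 : 0 ≤ K := by positivity
  refine ⟨(K ^ (1 / q)).toNNReal, fun f g hf h => ?_⟩
  -- The level sets of `f` enter a Tonelli argument, so `f` is replaced by a measurable
  -- representative.
  wlog hfm : Measurable f generalizing f
  · have hfm' := hf.1.stronglyMeasurable_mk.measurable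
    have hae := hf.1.ae_eq_mk
    rw [eLpNorm_congr_ae hae]
    exact this _ (hf.ae_eq hae) (h.congr hae (ae_eq_refl _)) hfm'
  have hfi : Integrable (fun x => ‖f x‖ ^ p) := by
    have := hf.integrable_norm_rpow (by simpa using hp0) ENNReal.ofReal_ne_top
    rwa [ENNReal.toReal_ofReal hp0.le] at this
  have hN0 : 0 ≤ ∫ x, ‖f x‖ ^ p := integral_nonneg fun x => by positivity
  -- The cut height divides by `N`; when `N = 0`, uniqueness gives `g = 0` almost everywhere.
  rcases hN0.eq_or_lt with hN | hN
  · have hf0 : f =ᵐ[volume] fun _ => 0 := by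
      filter_upwards [(integral_eq_zero_iff_of_nonneg (fun x => by positivity) hfi).1 hN.symm]
        with x hx
      simpa using ((Real.rpow_eq_zero_iff_of_nonneg (norm_nonneg (f x))).1 hx).1
    have hg0 : g =ᵐ[volume] fun _ => 0 :=
      (h.congr hf0 (ae_eq_refl _)).ae_unique IsWeakFourier.zero
    rw [eLpNorm_congr_ae hg0]
    simp
  · have hmain := h.lintegral_rpow_le hp1 hp2 hq hfm hfi hN
    have hnf : eLpNorm f (ENNReal.ofReal p) volume
        = ENNReal.ofReal ((∫ x, ‖f x‖ ^ p) ^ (1 / p)) := by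
      rw [eLpNorm_eq_lintegral_rpow_enorm_toReal (by simpa using hp0) ENNReal.ofReal_ne_top,
        ENNReal.toReal_ofReal hp0.le, ← ENNReal.ofReal_rpow_of_pos hN,
        ofReal_integral_eq_lintegral_ofReal hfi (Eventually.of_forall fun x => by positivity)]
      congr 1
      refine lintegral_congr fun x => ?_
      rw [← ofReal_norm, ENNReal.ofReal_rpow_of_nonneg (norm_nonneg _) hp0.le]
    rw [hnf, eLpNorm_eq_lintegral_rpow_enorm_toReal (by simpa using hq0) ENNReal.ofReal_ne_top,
        ENNReal.toReal_ofReal hq0.le]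
    have hgl : ∫⁻ x, ‖g x‖ₑ ^ q = ∫⁻ x, ENNReal.ofReal (‖g x‖ ^ q) := by
      refine lintegral_congr fun x => ?_
      rw [← ofReal_norm, ENNReal.ofReal_rpow_of_nonneg (norm_nonneg _) hq0.le]
    rw [hgl]
    refine (ENNReal.rpow_le_rpow hmain (by positivity)).trans_eq ?_
    rw [ENNReal.ofReal_rpow_of_nonneg (by positivity) (by positivity),
      Real.mul_rpow hK0 (by positivity), ENNReal.ofReal_mul (by positivity),
      ← Real.rpow_mul hN.le]
    congr 3
    rw [hq]
    field_simp
    ring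

end HausdorffYoung

/-! ### Polar coordinates and spherical averages. -/

section Polar

variable {n : ℕ}

theorem lintegral_eq_lintegral_sphere {G : EuclideanSpace ℝ (Fin n) → ℝ≥0∞} (hn : n ≠ 0)
    (hG : Measurable G) : ∫⁻ x, G x = ∫⁻ r : Set.Ioi (0 : ℝ),
      ∫⁻ ω : Metric.sphere (0 : EuclideanSpace ℝ (Fin n)) 1, G ((r : ℝ) • (ω : _))
        ∂(volume : Measure (EuclideanSpace ℝ (Fin n))).toSphere ∂(Measure.volumeIoiPow (n - 1)) := by
  have : Nonempty (Fin n) := Fin.pos_iff_nonempty.1 (Nat.pos_of_ne_zero hn)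
  have hmp := (volume : Measure (EuclideanSpace ℝ (Fin n))).measurePreserving_homeomorphUnitSphereProd
  rw [finrank_euclideanSpace_fin] at hmp
  rw [← lintegral_prod_symm
    (fun z : Metric.sphere (0 : EuclideanSpace ℝ (Fin n)) 1 × Set.Ioi (0 : ℝ) =>
      G ((z.2 : ℝ) • (z.1 : EuclideanSpace ℝ (Fin n)))) (hG.comp (by fun_prop)).aemeasurable,
    ← hmp.lintegral_comp_emb (Homeomorph.measurableEmbedding _)]
  calc ∫⁻ x, G x = ∫⁻ x in {0}ᶜ, G x := by rw [restrict_compl_singleton]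
    _ = ∫⁻ x : ({0}ᶜ : Set (EuclideanSpace ℝ (Fin n))), G x ∂(volume.comap Subtype.val) :=
      (lintegral_subtype_comap (measurableSet_singleton _).compl _).symm
    _ = _ := by
      refine lintegral_congr fun x => ?_
      have hx : ‖(x : EuclideanSpace ℝ (Fin n))‖ ≠ 0 := norm_ne_zero_iff.2 x.2
      simp [smul_smul, mul_inv_cancel₀ hx]

theorem measurable_lintegral_sphere {G : EuclideanSpace ℝ (Fin n) → ℝ≥0∞} (hG : Measurable G) :
    Measurable fun r : Set.Ioi (0 : ℝ) =>
      ∫⁻ ω : Metric.sphere (0 : EuclideanSpace ℝ (Fin n)) 1, G ((r : ℝ) • (ω : _))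
        ∂(volume : Measure (EuclideanSpace ℝ (Fin n))).toSphere := by
  refine Measurable.lintegral_prod_right' (f := fun z : Set.Ioi (0 : ℝ) ×
    Metric.sphere (0 : EuclideanSpace ℝ (Fin n)) 1 =>
      G ((z.1 : ℝ) • (z.2 : EuclideanSpace ℝ (Fin n)))) ?_
  exact hG.comp (by fun_prop)

/-- The inner and outer exponents agree, so the root cancels and only integration in polar
coordinates remains. -/
theorem eLpNorm_sphere {G : EuclideanSpace ℝ (Fin n) → ℂ} (hn : n ≠ 0) (hG : Measurable G)
    {q : ℝ} (hq : 0 < q) {T : Set ℝ} (hT : MeasurableSet T) :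
    eLpNorm (fun r : Set.Ioi (0 : ℝ) =>
      (∫⁻ ω : Metric.sphere (0 : EuclideanSpace ℝ (Fin n)) 1,
        ‖G ((r : ℝ) • (ω : EuclideanSpace ℝ (Fin n)))‖ₑ ^ q
          ∂(volume : Measure (EuclideanSpace ℝ (Fin n))).toSphere) ^ (1 / q)) (ENNReal.ofReal q)
      ((Measure.volumeIoiPow (n - 1)).restrict {r | (r : ℝ) ∈ T})
    = eLpNorm G (ENNReal.ofReal q) (volume.restrict {x | ‖x‖ ∈ T}) := by
  have hT1 : MeasurableSet {r : Set.Ioi (0 : ℝ) | (r : ℝ) ∈ T} := measurable_subtype_coe hT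
  have hT2 : MeasurableSet {x : EuclideanSpace ℝ (Fin n) | ‖x‖ ∈ T} := measurable_norm hT
  rw [eLpNorm_eq_lintegral_rpow_enorm_toReal (by simpa using hq) ENNReal.ofReal_ne_top,
    eLpNorm_eq_lintegral_rpow_enorm_toReal (by simpa using hq) ENNReal.ofReal_ne_top,
    ENNReal.toReal_ofReal hq.le]
  congr 1
  rw [← lintegral_indicator hT2, lintegral_eq_lintegral_sphere hn
    ((hG.enorm.pow_const _).indicator hT2), ← lintegral_indicator hT1]
  refine lintegral_congr fun r => ?_
  have hnorm : ∀ ω : Metric.sphere (0 : EuclideanSpace ℝ (Fin n)) 1,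
      ‖(r : ℝ) • (ω : EuclideanSpace ℝ (Fin n))‖ = r := by
    intro ω
    have : (0 : ℝ) < r := r.2
    simp [norm_smul, abs_of_pos this]
  by_cases hr : (r : ℝ) ∈ T
  · simp only [Set.indicator, Set.mem_ofPred_eq, hr, hnorm, if_true, enorm_eq_self]
    rw [← ENNReal.rpow_mul, one_div_mul_cancel hq.ne', ENNReal.rpow_one]
  · simp only [Set.indicator, Set.mem_ofPred_eq, hr, hnorm, if_false, lintegral_zero]

/-- A larger value at one point would persist on a nonempty open set, which has positive measure.
Single spheres are null, so `p = 1` needs this pointwise bound. -/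
theorem enorm_le_eLpNorm_top_restrict {E : Type*} [NormedAddCommGroup E] [MeasurableSpace E]
    [BorelSpace E] {ν : Measure E} [ν.IsOpenPosMeasure] {G : E → ℂ} (hG : Continuous G)
    {U : Set E} (hU : IsOpen U) {x : E} (hx : x ∈ U) :
    ‖G x‖ₑ ≤ eLpNorm G ∞ (ν.restrict U) := by
  by_contra! hlt
  have hae : ∀ᵐ y ∂ν.restrict U, ‖G y‖ₑ ≤ eLpNorm G ∞ (ν.restrict U) := by
    rw [eLpNorm_exponent_top]
    exact enorm_ae_le_eLpNormEssSup G _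
  rw [ae_restrict_iff' hU.measurableSet] at hae
  have hV : IsOpen (U ∩ {y | eLpNorm G ∞ (ν.restrict U) < ‖G y‖ₑ}) :=
    hU.inter (isOpen_lt continuous_const hG.enorm)
  refine hV.measure_ne_zero ν ⟨x, hx, hlt⟩ (measure_mono_null ?_ hae)
  rintro y ⟨hy, hy'⟩ h
  exact absurd (h hy) (not_le.2 hy')

theorem eLpNorm_top_iSup_sphere_le {G : EuclideanSpace ℝ (Fin n) → ℂ} (hG : Continuous G)
    {T : Set ℝ} (hT : IsOpen T) :
    eLpNorm (fun r : Set.Ioi (0 : ℝ) =>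
      ⨆ ω : Metric.sphere (0 : EuclideanSpace ℝ (Fin n)) 1,
        ‖G ((r : ℝ) • (ω : EuclideanSpace ℝ (Fin n)))‖ₑ) ∞
      ((Measure.volumeIoiPow (n - 1)).restrict {r | (r : ℝ) ∈ T})
    ≤ eLpNorm G ∞ (volume.restrict {x | ‖x‖ ∈ T}) := by
  have hT1 : MeasurableSet {r : Set.Ioi (0 : ℝ) | (r : ℝ) ∈ T} :=
    measurable_subtype_coe hT.measurableSet
  rw [eLpNorm_exponent_top (f := fun r : Set.Ioi (0 : ℝ) => _)]
  refine essSup_le_of_ae_le _ ?_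
  filter_upwards [ae_restrict_mem hT1] with r hr
  rw [enorm_eq_self]
  refine iSup_le fun ω => enorm_le_eLpNorm_top_restrict hG (hT.preimage continuous_norm) ?_
  have hr0 : (0 : ℝ) < r := r.2
  simpa [norm_smul, abs_of_pos hr0] using hr

/-- The supremum is uncountable, but a supremum of continuous functions is lower semicontinuous. -/
theorem measurable_iSup_sphere {G : EuclideanSpace ℝ (Fin n) → ℂ} (hG : Continuous G) :
    Measurable fun r : Set.Ioi (0 : ℝ) =>
      ⨆ ω : Metric.sphere (0 : EuclideanSpace ℝ (Fin n)) 1,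
        ‖G ((r : ℝ) • (ω : EuclideanSpace ℝ (Fin n)))‖ₑ := by
  refine LowerSemicontinuous.measurable (lowerSemicontinuous_iSup fun ω =>
    Continuous.lowerSemicontinuous ?_)
  exact (hG.comp (by fun_prop)).enorm

end Polar

/-! ### From tail decay to lower integrability exponents. -/

section Tail

theorem volumeIoiPow_lt_le (m : ℕ) {a : ℝ} (ha : 0 < a) :
    Measure.volumeIoiPow m {r | (r : ℝ) < a} ≤ ENNReal.ofReal (a ^ (m + 1)) := by
  have : {r : Set.Ioi (0 : ℝ) | (r : ℝ) < a} = Set.Iio ⟨a, ha⟩ := by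
    ext r; simp [← Subtype.coe_lt_coe]
  rw [this, Measure.volumeIoiPow_apply_Iio]
  refine ENNReal.ofReal_le_ofReal (div_le_self (by positivity) ?_)
  have : (0 : ℝ) ≤ m := Nat.cast_nonneg m
  linarith

/-- A decay rate for the tails of an `L^q` function in polar coordinates gives integrability to
smaller powers. -/
theorem eLpNorm_lt_top_of_tail_le {m : ℕ} {F : Set.Ioi (0 : ℝ) → ℝ≥0∞} (hF : Measurable F)
    {q : ℝ≥0∞} (hq : eLpNorm F q (Measure.volumeIoiPow m) < ∞) {A : ℝ≥0∞} (hA : A ≠ ∞)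
    {R₀ α : ℝ} (hR₀ : 0 < R₀)
    (htail : ∀ R, R₀ ≤ R → eLpNorm F q ((Measure.volumeIoiPow m).restrict {r | (r : ℝ) ∈ Set.Ioi R})
      ≤ A * ENNReal.ofReal (R ^ (-α)))
    {b : ℝ} (hb : 0 < b) (hbq : ENNReal.ofReal b ≤ q)
    (hlt : (m + 1) * (1 / b - 1 / q.toReal) < α) :
    eLpNorm F (ENNReal.ofReal b) (Measure.volumeIoiPow m) < ∞ := by
  set ρ := Measure.volumeIoiPow m with hρ
  -- For `q = ∞` the conventions `∞.toReal = 0` and `1 / 0 = 0` give the right value `e = 1 / b`.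
  set e := 1 / b - 1 / q.toReal with he
  have he0 : 0 ≤ e := by
    rcases eq_or_ne q ∞ with rfl | hq'
    · simp only [he, ENNReal.toReal_top, div_zero, sub_zero]
      positivity
    · rw [he, sub_nonneg]
      exact one_div_le_one_div_of_le hb ((ENNReal.ofReal_le_iff_le_toReal hq').1 hbq)
  have holder : ∀ {S : Set (Set.Ioi (0 : ℝ))} {a : ℝ}, 0 < a → S ⊆ {r | (r : ℝ) < a} →
      eLpNorm F (ENNReal.ofReal b) (ρ.restrict S)
        ≤ eLpNorm F q (ρ.restrict S) * ENNReal.ofReal ((a ^ (m + 1)) ^ e) := by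
    intro S a ha hS
    have h := eLpNorm_le_eLpNorm_mul_rpow_measure_univ (μ := ρ.restrict S) hbq
      hF.aestronglyMeasurable
    rw [ENNReal.toReal_ofReal hb.le, Measure.restrict_apply_univ] at h
    refine h.trans (mul_le_mul_right ?_ _)
    rw [← ENNReal.ofReal_rpow_of_nonneg (by positivity) he0]
    exact ENNReal.rpow_le_rpow ((measure_mono hS).trans (volumeIoiPow_lt_le m ha)) he0
  have hpow : ∀ ν : Measure (Set.Ioi (0 : ℝ)),
      ∫⁻ r, F r ^ b ∂ν = eLpNorm F (ENNReal.ofReal b) ν ^ b := by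
    intro ν
    rw [eLpNorm_eq_lintegral_rpow_enorm_toReal (by simpa using hb) ENNReal.ofReal_ne_top,
      ENNReal.toReal_ofReal hb.le, ← ENNReal.rpow_mul, one_div_mul_cancel hb.ne', ENNReal.rpow_one]
    simp
  let a : ℕ → ℝ := fun j => R₀ * 2 ^ j
  have ha : ∀ j, 0 < a j := fun j => by positivity
  -- The ratio 4 makes consecutive shells overlap, so open intervals cover everything from `2 R₀` on
  -- and each lies in the open tail beyond `a j`.
  let S : ℕ → Set (Set.Ioi (0 : ℝ)) := fun j => {r | (r : ℝ) ∈ Set.Ioo (a j) (4 * a j)}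
  let S₀ : Set (Set.Ioi (0 : ℝ)) := {r | (r : ℝ) < 2 * R₀}
  have hcover : (Set.univ : Set (Set.Ioi (0 : ℝ))) ⊆ S₀ ∪ ⋃ j, S j := by
    intro r _
    by_cases hr : (r : ℝ) < 2 * R₀
    · exact Or.inl hr
    · right
      obtain ⟨j, hj1, hj2⟩ := exists_nat_pow_near (x := (r : ℝ) / (2 * R₀)) (y := 2)
        (by rw [le_div_iff₀ (by positivity)]; linarith) one_lt_two
      rw [le_div_iff₀ (by positivity)] at hj1
      rw [div_lt_iff₀ (by positivity), pow_succ] at hj2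
      refine Set.mem_iUnion.2 ⟨j, ?_, ?_⟩
      · have := ha j
        simp only [a] at this ⊢
        nlinarith
      · simp only [a]
        nlinarith
  -- `2 ^ θ` is the ratio of the geometric series bounding the shell integrals; `hlt` makes it less
  -- than 1.
  set θ : ℝ := ((m + 1) * e - α) * b with hθ
  have hθ0 : θ < 0 := mul_neg_of_neg_of_pos (by linarith) hb
  set D : ℝ≥0∞ := (A * ENNReal.ofReal (((4 : ℝ) ^ (m + 1)) ^ e * R₀ ^ ((m + 1) * e - α))) ^ b with hD
  have hDtop : D ≠ ∞ := ENNReal.rpow_ne_top_of_nonneg hb.le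
    (ENNReal.mul_ne_top hA ENNReal.ofReal_ne_top)
  have hterm : ∀ j, ∫⁻ r in S j, F r ^ b ∂ρ ≤ D * ENNReal.ofReal (2 ^ θ) ^ j := by
    intro j
    have h1 : eLpNorm F (ENNReal.ofReal b) (ρ.restrict (S j))
        ≤ A * ENNReal.ofReal (((4 : ℝ) ^ (m + 1)) ^ e * a j ^ ((m + 1) * e - α)) := by
      refine (holder (a := 4 * a j) (by have := ha j; positivity) fun r hr => hr.2).trans ?_
      have hmono : eLpNorm F q (ρ.restrict (S j)) ≤ A * ENNReal.ofReal (a j ^ (-α)) := by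
        refine (eLpNorm_mono_measure _ (Measure.restrict_mono (fun r hr => hr.1) le_rfl)).trans
          (htail (a j) ?_)
        have : (1 : ℝ) ≤ 2 ^ j := one_le_pow₀ one_le_two
        simp only [a]
        nlinarith
      grw [hmono]
      rw [mul_assoc, ← ENNReal.ofReal_mul (by have := ha j; positivity)]
      refine mul_le_mul_right (ENNReal.ofReal_le_ofReal (le_of_eq ?_)) _
      have haj := ha j
      generalize a j = u at haj ⊢
      rw [mul_pow, Real.mul_rpow (by positivity) (by positivity), sub_eq_add_neg,
        Real.rpow_add haj, Real.rpow_mul haj.le, ← Nat.cast_add_one, Real.rpow_natCast]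
      ring
    rw [hpow]
    refine (ENNReal.rpow_le_rpow h1 hb.le).trans_eq ?_
    have h2 : a j ^ ((m + 1) * e - α) = R₀ ^ ((m + 1) * e - α) * (2 ^ j) ^ ((m + 1) * e - α) :=
      Real.mul_rpow hR₀.le (by positivity)
    rw [h2, ← mul_assoc, ENNReal.ofReal_mul (by positivity), ← mul_assoc,
      ENNReal.mul_rpow_of_nonneg _ _ hb.le, ENNReal.ofReal_rpow_of_nonneg (by positivity) hb.le,
      ← ENNReal.ofReal_pow (by positivity)]
    congr 2
    rw [← Real.rpow_mul (by positivity), ← hθ, ← Real.rpow_natCast, ← Real.rpow_natCast,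
      ← Real.rpow_mul (by norm_num), ← Real.rpow_mul (by norm_num), mul_comm]
  have hlow : ∫⁻ r in S₀, F r ^ b ∂ρ < ∞ := by
    rw [hpow]
    refine ENNReal.rpow_lt_top_of_nonneg hb.le (ne_of_lt ?_)
    refine (holder (a := 2 * R₀) (by positivity) fun r hr => hr).trans_lt ?_
    exact ENNReal.mul_lt_top ((eLpNorm_mono_measure _ Measure.restrict_le_self).trans_lt hq)
      ENNReal.ofReal_lt_top
  have hall : ∫⁻ r, F r ^ b ∂ρ < ∞ := by
    calc ∫⁻ r, F r ^ b ∂ρ = ∫⁻ r in Set.univ, F r ^ b ∂ρ := by rw [setLIntegral_univ]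
      _ ≤ ∫⁻ r in S₀ ∪ ⋃ j, S j, F r ^ b ∂ρ := lintegral_mono_set hcover
      _ ≤ ∫⁻ r in S₀, F r ^ b ∂ρ + ∫⁻ r in ⋃ j, S j, F r ^ b ∂ρ := lintegral_union_le _ _ _
      _ ≤ ∫⁻ r in S₀, F r ^ b ∂ρ + ∑' j, ∫⁻ r in S j, F r ^ b ∂ρ := by
          grw [lintegral_iUnion_le]
      _ ≤ ∫⁻ r in S₀, F r ^ b ∂ρ + ∑' j, D * ENNReal.ofReal (2 ^ θ) ^ j := by
          gcongr with j
          exact hterm j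
      _ < ∞ := by
          rw [ENNReal.tsum_mul_left, ENNReal.tsum_geometric]
          refine ENNReal.add_lt_top.2 ⟨hlow, ENNReal.mul_lt_top hDtop.lt_top ?_⟩
          refine ENNReal.inv_lt_top.2 (tsub_pos_of_lt ?_)
          rw [← ENNReal.ofReal_one]
          exact (ENNReal.ofReal_lt_ofReal_iff one_pos).2
            (Real.rpow_lt_one_of_one_lt_of_neg one_lt_two hθ0)
  rw [hpow] at hall
  by_contra! h
  rw [top_le_iff.1 h, ENNReal.top_rpow_of_pos hb] at hall
  exact lt_irrefl _ hall

end Tail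

/-! ### Tail decay of the transform and the conclusion. -/

section Main

theorem eLpNorm_comp_smul_le {E : Type*} [NormedAddCommGroup E] [NormedSpace ℝ E]
    [MeasurableSpace E] [BorelSpace E] [FiniteDimensional ℝ E] (ν : Measure E) [ν.IsAddHaarMeasure]
    (q : ℝ≥0∞) {a : ℝ} (ha : a ≠ 0) :
    ∃ D : ℝ≥0, ∀ H : E → ℂ, AEStronglyMeasurable H ν →
      eLpNorm (fun x => H (a • x)) q ν ≤ D * eLpNorm H q ν := by
  set c : ℝ≥0∞ := ENNReal.ofReal |(a ^ Module.finrank ℝ E)⁻¹| with hc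
  have hc0 : c ≠ 0 := by
    rw [hc, Ne, ENNReal.ofReal_eq_zero, not_le, abs_pos]
    exact inv_ne_zero (pow_ne_zero _ ha)
  refine ⟨(c ^ (1 / q).toReal).toNNReal, fun H hH => ?_⟩
  have hmap : Measure.map (a • ·) ν = c • ν := Measure.map_addHaar_smul ν ha
  have hH' : AEStronglyMeasurable H (Measure.map (a • ·) ν) := by
    rw [hmap]; exact hH.smul_measure c
  have h := eLpNorm_map_measure (p := q) hH' (measurable_const_smul a).aemeasurable
  rw [hmap, eLpNorm_smul_measure_of_ne_zero hc0] at h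
  rw [ENNReal.coe_toNNReal (ENNReal.rpow_ne_top_of_nonneg ENNReal.toReal_nonneg
    ENNReal.ofReal_ne_top)]
  exact h.ge

theorem conjExp_one : conjExp 1 = ∞ := by simp [conjExp]

theorem conjExp_of_one_lt {p : ℝ} (hp : 1 < p) : conjExp p = ENNReal.ofReal (p / (p - 1)) := by
  simp [conjExp, hp.ne']

theorem one_div_toReal_conjExp {p : ℝ} (hp : 1 ≤ p) : 1 / (conjExp p).toReal = 1 - 1 / p := by
  rcases hp.eq_or_lt with rfl | hp
  · simp [conjExp_one]
  · have : 0 < p - 1 := by linarith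
    rw [conjExp_of_one_lt hp, ENNReal.toReal_ofReal (by positivity)]
    field_simp

/-- The Fourier transform maps `L^p` to `L^{p'}` for `1 ≤ p ≤ 2`. -/
theorem IsWeakFourier.exists_eLpNorm_conjExp_le {E : Type*} [NormedAddCommGroup E]
    [InnerProductSpace ℝ E] [FiniteDimensional ℝ E] [MeasurableSpace E] [BorelSpace E]
    {p : ℝ} (hp1 : 1 ≤ p) (hp2 : p ≤ 2) :
    ∃ C : ℝ≥0, ∀ f g : E → ℂ, MemLp f (ENNReal.ofReal p) → IsWeakFourier f g →
      eLpNorm g (conjExp p) volume ≤ C * eLpNorm f (ENNReal.ofReal p) volume := by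
  rcases hp1.eq_or_lt with rfl | hp1
  · refine ⟨1, fun f g hf h => ?_⟩
    rw [ENNReal.ofReal_one] at hf ⊢
    have hi := memLp_one_iff_integrable.1 hf
    rw [conjExp_one, eLpNorm_congr_ae (h.ae_unique (IsWeakFourier.of_integrable hi)),
      eLpNorm_exponent_top, ENNReal.coe_one, one_mul, eLpNorm_one_eq_lintegral_enorm,
      ← ofReal_integral_norm_eq_lintegral_enorm hi]
    refine essSup_le_of_ae_le _ (Eventually.of_forall fun x => ?_)
    beta_reduce
    rw [← ofReal_norm]
    exact ENNReal.ofReal_le_ofReal (VectorFourier.norm_fourierIntegral_le_integral_norm _ _ _ _ _)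
  · rw [conjExp_of_one_lt hp1]
    exact IsWeakFourier.exists_eLpNorm_le hp1 hp2

variable {n : ℕ}

theorem measurable_hatLp {f : EuclideanSpace ℝ (Fin n) → ℂ} {p : ℝ} (hp1 : 1 ≤ p) (hp2 : p ≤ 2)
    (hf : MemLp f (ENNReal.ofReal p)) : Measurable (hatLp f hp1 hp2 hf) := by
  have h1 : Measurable (𝓕 (largePart f)) :=
    (VectorFourier.fourierIntegral_continuous Real.continuous_fourierChar
      (by simpa using! continuous_inner)
      (memLp_one_iff_integrable.1 (memLp_largePart hp1 hf))).measurable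
  have h2 := (Lp.stronglyMeasurable (𝓕 ((memLp_smallPart hp1 hp2 hf).toLp (smallPart f)) :
    Lp ℂ 2 (volume : Measure (EuclideanSpace ℝ (Fin n))))).measurable
  exact (h1.comp (measurable_const_smul _)).add (h2.comp (measurable_const_smul _))

theorem continuous_hatL1 {f : EuclideanSpace ℝ (Fin n) → ℂ} (hf : Integrable f) :
    Continuous (hatL1 f) :=
  (VectorFourier.fourierIntegral_continuous Real.continuous_fourierChar
      (by simpa using! continuous_inner) hf).comp (continuous_const_smul _)

theorem exists_isWeakFourier_hatLp {f : EuclideanSpace ℝ (Fin n) → ℂ} {p : ℝ} (hp1 : 1 ≤ p)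
    (hp2 : p ≤ 2) (hf : MemLp f (ENNReal.ofReal p)) :
    ∃ G, IsWeakFourier f G ∧ hatLp f hp1 hp2 hf = fun ξ => G ((2 * Real.pi)⁻¹ • ξ) := by
  have h1 := IsWeakFourier.of_integrable (memLp_one_iff_integrable.1 (memLp_largePart hp1 hf))
  have h2 := IsWeakFourier.of_memLp_two (memLp_smallPart hp1 hp2 hf)
  exact ⟨_, (h1.add h2).congr
    (Eventually.of_forall fun x => congrFun (largePart_add_smallPart f) x) (ae_eq_refl _), rfl⟩

/-- The Fourier transform of a function with an `O(t^α)` averaging modulus has `L^{p'}`-tails of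
order `R^{-α}`. -/
theorem IsWeakFourier.exists_tail_le {σ : ℝ} {μ : ComplexMeasure (EuclideanSpace ℝ (Fin n))}
    (hσ : 0 < σ) (hμ : μ ∈ KClass n σ) {p : ℝ} (hp1 : 1 ≤ p) (hp2 : p ≤ 2)
    {f G : EuclideanSpace ℝ (Fin n) → ℂ} (hf : MemLp f (ENNReal.ofReal p)) {α : ℝ}
    (hO : ∃ C : ℝ≥0, ∀ᶠ t : ℝ in 𝓝[>] 0,
      eLpNorm (fun x => _root_.averagingOp μ t f x - f x) (ENNReal.ofReal p) volume
        ≤ C * ENNReal.ofReal (t ^ α))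
    (hG : IsWeakFourier f G) :
    (eLpNorm (fun ξ => G ((2 * Real.pi)⁻¹ • ξ)) (conjExp p) volume < ∞) ∧
    ∃ A : ℝ≥0, ∃ R₀ : ℝ, 0 < R₀ ∧ ∀ R, R₀ ≤ R →
      eLpNorm (fun ξ => G ((2 * Real.pi)⁻¹ • ξ)) (conjExp p) (volume.restrict {ξ | ‖ξ‖ ∈ Set.Ioi R})
        ≤ A * ENNReal.ofReal (R ^ (-α)) := by
  have hpi : (2 * Real.pi)⁻¹ ≠ 0 := by positivity
  have hp : 1 ≤ ENNReal.ofReal p := by simpa using hp1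
  obtain ⟨K, hK⟩ := IsWeakFourier.exists_eLpNorm_conjExp_le (E := EuclideanSpace ℝ (Fin n)) hp1 hp2
  obtain ⟨D, hD⟩ := eLpNorm_comp_smul_le (volume : Measure (EuclideanSpace ℝ (Fin n)))
    (conjExp p) hpi
  obtain ⟨-, c, _, hc, -, hcC⟩ := hμ
  obtain ⟨C, hC⟩ := hO
  refine ⟨?_, c.toNNReal⁻¹ * (D * (K * C)), ?_⟩
  · refine (hD G hG.aestronglyMeasurable).trans_lt (ENNReal.mul_lt_top ENNReal.coe_lt_top ?_)
    exact (hK f G hf hG).trans_lt (ENNReal.mul_lt_top ENNReal.coe_lt_top hf.2)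
  obtain ⟨ε, hε, hεC⟩ := mem_nhdsGT_iff_exists_Ioo_subset.1 hC
  have hε0 : (0 : ℝ) < ε := hε
  -- The factor 2 keeps `R⁻¹` strictly below `ε`.
  refine ⟨2 / ε, by positivity, fun R hR => ?_⟩
  have hR0 : 0 < R := lt_of_lt_of_le (by positivity) hR
  have hmem : R⁻¹ ∈ Set.Ioo 0 ε := by
    refine ⟨by positivity, ?_⟩
    rw [inv_lt_comm₀ hR0 hε0]
    refine lt_of_lt_of_le ?_ hR
    rw [inv_eq_one_div]
    gcongr
    norm_num
  have hbound : eLpNorm (fun x => _root_.averagingOp μ R⁻¹ f x - f x) (ENNReal.ofReal p) volume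
        ≤ C * ENNReal.ofReal (R⁻¹ ^ α) := hεC hmem
  -- Finiteness of the norm is read off from the `O(t^α)` bound itself.
  have hdiff : MemLp (fun x => _root_.averagingOp μ R⁻¹ f x - f x) (ENNReal.ofReal p) :=
    ⟨(aestronglyMeasurable_averagingOp μ hp hf _).sub hf.1, hbound.trans_lt
      (ENNReal.mul_lt_top ENNReal.coe_lt_top ENNReal.ofReal_lt_top)⟩
  have hw := (hG.averagingOp μ hp hf R⁻¹).sub hG
  have h1 := hK _ _ hdiff hw
  have h2 := hD _ hw.aestronglyMeasurable
  have h3 : ∀ᵐ ξ ∂(volume.restrict {ξ : EuclideanSpace ℝ (Fin n) | ‖ξ‖ ∈ Set.Ioi R}),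
      ‖G ((2 * Real.pi)⁻¹ • ξ)‖ ≤ c⁻¹ * ‖hatMeasure μ ((2 * Real.pi * R⁻¹) • (2 * Real.pi)⁻¹ • ξ)
        * G ((2 * Real.pi)⁻¹ • ξ) - G ((2 * Real.pi)⁻¹ • ξ)‖ := by
    filter_upwards [ae_restrict_mem (measurable_norm measurableSet_Ioi)] with ξ hξ
    have hξ' : R < ‖ξ‖ := hξ
    have h4 : (2 * Real.pi * R⁻¹) • (2 * Real.pi)⁻¹ • ξ = R⁻¹ • ξ := by
      rw [smul_smul]; congr 1; field_simp
    have h5 := (hcC (R⁻¹ • ξ)).1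
    -- Frequencies beyond `R`, scaled by `R⁻¹`, leave the unit ball, where the minimum in `K_σ`
    -- equals 1.
    have h6 : 1 ≤ ‖R⁻¹ • ξ‖ ^ (2 * σ) := by
      refine Real.one_le_rpow ?_ (by positivity)
      rw [norm_smul, Real.norm_of_nonneg (by positivity), ← div_eq_inv_mul, le_div_iff₀ hR0]
      linarith
    rw [min_eq_left h6, mul_one] at h5
    rw [h4, ← sub_one_mul, norm_mul, norm_sub_rev, ← mul_assoc]
    refine le_mul_of_one_le_left (norm_nonneg _) ?_
    rw [← div_eq_inv_mul, le_div_iff₀ hc]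
    linarith
  calc eLpNorm (fun ξ => G ((2 * Real.pi)⁻¹ • ξ)) (conjExp p)
        (volume.restrict {ξ | ‖ξ‖ ∈ Set.Ioi R})
      ≤ ENNReal.ofReal c⁻¹ * eLpNorm (fun ξ => hatMeasure μ ((2 * Real.pi * R⁻¹) •
          (2 * Real.pi)⁻¹ • ξ) * G ((2 * Real.pi)⁻¹ • ξ) - G ((2 * Real.pi)⁻¹ • ξ)) (conjExp p)
        (volume.restrict {ξ | ‖ξ‖ ∈ Set.Ioi R}) := eLpNorm_le_mul_eLpNorm_of_ae_le_mul h3 _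
    _ ≤ ENNReal.ofReal c⁻¹ * (D * (K * (C * ENNReal.ofReal (R⁻¹ ^ α)))) := by
        gcongr
        refine (eLpNorm_mono_measure _ Measure.restrict_le_self).trans (h2.trans ?_)
        gcongr
        exact h1.trans (by gcongr)
    _ = _ := by
        rw [Real.inv_rpow hR0.le, ← Real.rpow_neg hR0.le, ENNReal.ofReal,
          Real.toNNReal_inv]
        push_cast
        ring

theorem mainTheorem2 (n : ℕ) (hn : 2 ≤ n) (σ : ℝ) (hσ : 0 < σ)
    (μ : ComplexMeasure (EuclideanSpace ℝ (Fin n))) (hμ : μ ∈ KClass n σ)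
    (p : ℝ) (hp1 : 1 ≤ p) (hp2 : p ≤ 2)
    (f : EuclideanSpace ℝ (Fin n) → ℂ) (hf : MemLp f (ENNReal.ofReal p))
    (α : ℝ) (hα0 : 0 < α) (hα : α ≤ 2 * σ)
    (hO : ∃ C : ℝ≥0, ∀ᶠ t : ℝ in 𝓝[>] 0,
      eLpNorm (fun x => averagingOp μ t f x - f x) (ENNReal.ofReal p) volume
        ≤ C * ENNReal.ofReal (t ^ α))
    (β : ℝ≥0∞) (hβ : ENNReal.ofReal (n * p / (n * p + α * p - n)) < β) (hβ' : β ≤ conjExp p) :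
    MemLp (fun r : Set.Ioi (0 : ℝ) => sphericalAverage f hp1 hp2 hf r) β
      (Measure.volumeIoiPow (n - 1)) := by
  have hn0 : n ≠ 0 := by omega
  have hnpos : (0 : ℝ) < n := by exact_mod_cast Nat.pos_of_ne_zero hn0
  obtain ⟨hmeas, hfin, A, R₀, hR₀, htail⟩ :
      Measurable (fun r : Set.Ioi (0 : ℝ) => sphericalAverage f hp1 hp2 hf r) ∧
      eLpNorm (fun r : Set.Ioi (0 : ℝ) => sphericalAverage f hp1 hp2 hf r) (conjExp p)
        (Measure.volumeIoiPow (n - 1)) < ∞ ∧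
      ∃ A : ℝ≥0, ∃ R₀ : ℝ, 0 < R₀ ∧ ∀ R, R₀ ≤ R →
        eLpNorm (fun r : Set.Ioi (0 : ℝ) => sphericalAverage f hp1 hp2 hf r) (conjExp p)
          ((Measure.volumeIoiPow (n - 1)).restrict {r | (r : ℝ) ∈ Set.Ioi R})
            ≤ A * ENNReal.ofReal (R ^ (-α)) := by
    -- For `p = 1` the transform is continuous and essential suprema become suprema over spheres;
    -- for `p > 1` the measurable representative `hatLp` is integrated in polar coordinates.
    rcases hp1.eq_or_lt with rfl | hp1'
    · have hi : Integrable f := by simpa [memLp_one_iff_integrable] using hf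
      obtain ⟨h1, A, R₀, hR₀, h2⟩ :=
        (IsWeakFourier.of_integrable hi).exists_tail_le hσ hμ hp1 hp2 hf hO
      have hcont := continuous_hatL1 hi
      simp only [sphericalAverage, if_true, conjExp_one] at h1 h2 ⊢
      refine ⟨measurable_iSup_sphere hcont, ?_, A, R₀, hR₀, fun R hR => ?_⟩
      · have h := eLpNorm_top_iSup_sphere_le (n := n) hcont isOpen_univ
        simp only [Set.mem_univ, Set.ofPred_true, Measure.restrict_univ] at h
        exact h.trans_lt h1
      · exact (eLpNorm_top_iSup_sphere_le hcont isOpen_Ioi).trans (h2 R hR)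
    · obtain ⟨G, hG, hGeq⟩ := exists_isWeakFourier_hatLp hp1 hp2 hf
      obtain ⟨h1, A, R₀, hR₀, h2⟩ := hG.exists_tail_le hσ hμ hp1 hp2 hf hO
      rw [← hGeq] at h1 h2
      have hm := measurable_hatLp hp1 hp2 hf
      have hp10 : 0 < p - 1 := by linarith
      have hq : 0 < p / (p - 1) := by positivity
      simp only [sphericalAverage, hp1'.ne', if_false, conjExp_of_one_lt hp1',
        ENNReal.toReal_ofReal hq.le] at h1 h2 ⊢
      refine ⟨(measurable_lintegral_sphere (hm.enorm.pow_const _)).pow_const _, ?_, A, R₀, hR₀,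
        fun R hR => ?_⟩
      · have h := eLpNorm_sphere hn0 hm hq MeasurableSet.univ
        simp only [Set.mem_univ, Set.ofPred_true, Measure.restrict_univ] at h
        rwa [h]
      · rw [eLpNorm_sphere hn0 hm hq measurableSet_Ioi]
        exact h2 R hR
  refine ⟨hmeas.aestronglyMeasurable, ?_⟩
  rcases eq_or_ne β ∞ with rfl | hβtop
  · rwa [top_le_iff.1 hβ'] at hfin
  have hp0 : 0 < p := by linarith
  have hden : 0 < n * p + α * p - n := by nlinarith [mul_pos hα0 hp0]
  have hb : n * p / (n * p + α * p - n) < β.toReal :=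
    (ENNReal.ofReal_lt_iff_lt_toReal (by positivity) hβtop).1 hβ
  have hb0 : 0 < β.toReal := lt_of_le_of_lt (by positivity) hb
  rw [← ENNReal.ofReal_toReal hβtop] at hβ' ⊢
  refine eLpNorm_lt_top_of_tail_le hmeas hfin ENNReal.coe_ne_top hR₀ htail hb0 hβ' ?_
  rw [one_div_toReal_conjExp hp1, Nat.cast_sub (by omega), Nat.cast_one, sub_add_cancel]
  have h1 : 1 / β.toReal < (n * p + α * p - n) / (n * p) := by
    rw [div_lt_iff₀ hden] at hb
    rw [div_lt_div_iff₀ hb0 (by positivity)]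
    linarith
  -- At the endpoint `β = np/(np + αp - n)` the condition `n(1/β - 1/p') < α` becomes an equality.
  have h2 : (n : ℝ) * ((n * p + α * p - n) / (n * p) - (1 - 1 / p)) = α := by
    field_simp
    ring
  rw [← h2]
  exact mul_lt_mul_of_pos_left (by linarith) hnpos

end Main
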